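/- **Theorem (Cycle partition convergence).** A *partition of unity* is a nonincreasing sequence $x=(x_1,x_2,\dots)$ of nonnegative reals with $\sum_i x_i=1$; a finite or countable family of nonnegative numbers with sum $1$ is identified with the sequence obtained by sorting it in nonincreasing order (and padding with zeros). For a metric $\rho$ on partitions of unity and random partitions $X,Y$, let $d_\rho(X,Y)=\inf\mathbb E\,\rho(X',Y')$, the infimum being over all couplings $(X',Y')$ of the laws of $X$ and $Y$ (the Wasserstein distance); write $d_{L^\infty}$ and $d_{L^1}$ for $\rho(x,y)=\sup_i|x_i-y_i|$ and $\rho(x,y)=\sum_i|x_i-y_i|$. The *normalized cycle partition* of a permutation of $N$ points is the family of its cycle lengths (fixed points included), each divided by $N$. Let $m\ge 1$ and let $\Gamma\le S_m$ be a subgroup. Let $\mathcal B$ be the normalized cycle partition of a uniformly random element of $\Gamma$. Then there is exactly one law of a random partition of unity $\mathcal A$ such that $$\mathcal A=\bigl(U\mathcal B,\,(1-U)\mathcal A\bigr)\quad\text{in distribution},$$ where on the right-hand side $U$ is uniform on $[0,1]$ and $U,\mathcal B,\mathcal A$ are independent. For $n\ge 1$ let $\pi$ be uniform in $\Gamma^n\rtimes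 S_n\le S_{mn}$ (the group of permutations of $n$ blocks of size $m$ that permute the points within each block by an element of $\Gamma$ and permute the blocks arbitrarily), and let $C$ be its normalized cycle partition. Then for all $n\ge 1$ $$d_{L^\infty}(C,\mathcal A)\le\frac1n \qquad\text{and}\qquad d_{L^1}(C,\mathcal A)\le\frac{3(\log n+\gamma)}{n}+O\!\left(\frac1{n^2}\right),$$ where $\gamma$ is the Euler–Mascheroni constant and the implied constant is universal (it depends neither on $n$ nor on $m$ and $\Gamma$). -/

import Mathlib

open MeasureTheory

open scoped ENNReal

noncomputable section

namespace BlockPerm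

/-- Decreasing rearrangement of a family of nonnegative numbers, as a sequence: the `k`-th entry
(starting from `k = 0`) is the least `t ≥ 0` such that at most `k` members of the family
exceed `t`. For a finite family the sequence is padded with zeros. -/
def sortDesc {ι : Type*} (x : ι → ℝ) (k : ℕ) : ℝ :=
  sInf {t : ℝ | 0 ≤ t ∧ {i | t < x i}.encard ≤ k}

/-- The space `Δ` of partitions of unity, as nonincreasing sequences. -/
def partitionsOfUnity : Set (ℕ → ℝ) :=
  {x | (∀ i, 0 ≤ x i) ∧ HasSum x 1 ∧ Antitone x}

/-- The cycles of `σ`, fixed points included: the classes of the relation "in the same cycle". -/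
abbrev Cycles {α : Type*} (σ : Equiv.Perm α) : Type _ :=
  Quotient (Equiv.Perm.SameCycle.setoid σ)

/-- The length of a cycle: the number of points in it. -/
def cycleLength {α : Type*} {σ : Equiv.Perm α} (c : Cycles σ) : ℕ :=
  Nat.card {a : α // (Quotient.mk _ a : Cycles σ) = c}

/-- The normalized cycle partition of `σ`: the cycle lengths (fixed points included) divided by
the number of points, in nonincreasing order. -/
def cyclePartition {α : Type*} (σ : Equiv.Perm α) : ℕ → ℝ :=
  sortDesc fun c : Cycles σ => (cycleLength c : ℝ) / Nat.card α

open Classical in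
/-- The law of the normalized cycle partition of a uniformly random element of a group `G` of
permutations of a finite set. -/
def cycleLaw {α : Type*} [Fintype α] (G : Subgroup (Equiv.Perm α)) : Measure (ℕ → ℝ) :=
  ((PMF.uniformOfFintype G).map fun σ => cyclePartition (σ : Equiv.Perm α)).toMeasure

/-- The action of `Γ ^ n ⋊ S_n` on `n` blocks of size `m` (the `i`-th block being the set of pairs
`(i, a)`). In the semidirect product `(g, h) = (g, 1) * (1, h)`: here `(1, h)` permutes the blocks
by `h`, and `(g, 1)` acts on the `i`-th block by `g i`. -/
def wreathToPerm {m : ℕ} (Γ : Subgroup (Equiv.Perm (Fin m))) (n : ℕ) :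
    (Fin n → Γ) ⋊[mulAutArrow] Equiv.Perm (Fin n) →* Equiv.Perm (Fin n × Fin m) where
  toFun w :=
    { toFun := fun p => (w.right p.1, (w.left (w.right p.1) : Equiv.Perm (Fin m)) p.2)
      invFun := fun p => (w.right⁻¹ p.1, (w.left p.1 : Equiv.Perm (Fin m))⁻¹ p.2)
      left_inv := fun p => by simp
      right_inv := fun p => by simp }
  map_one' := by ext p <;> simp
  map_mul' w v := by
    have h : ∀ i, w.right⁻¹ (w.right i) = i := fun i => by simp
    refine Equiv.ext fun p => Prod.ext rfl ?_
    change ((w.left (w.right (v.right p.1)) *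
      v.left (w.right⁻¹ (w.right (v.right p.1))) : Γ) : Equiv.Perm (Fin m)) p.2 = _
    rw [h]
    rfl

/-- `Γ ^ n ⋊ S_n` as a group of permutations of the `m * n` points. -/
def wreath {m : ℕ} (Γ : Subgroup (Equiv.Perm (Fin m))) (n : ℕ) :
    Subgroup (Equiv.Perm (Fin n × Fin m)) :=
  (wreathToPerm Γ n).range

/-- The partition of unity `(u b, (1 - u) a)`. -/
def stickMerge (u : ℝ) (b a : ℕ → ℝ) : ℕ → ℝ :=
  sortDesc (Sum.elim (fun i => u * b i) (fun j => (1 - u) * a j) : ℕ ⊕ ℕ → ℝ)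

/-- `A` is the law of a random partition of unity `𝒜` with `𝒜 = (U ℬ, (1 - U) 𝒜)` in distribution,
where `U` is uniform on `[0, 1]`, `ℬ` has law `B`, and `U`, `ℬ`, `𝒜` on the right-hand side
are independent. -/
structure IsStickLaw (B A : Measure (ℕ → ℝ)) : Prop where
  isProbabilityMeasure : IsProbabilityMeasure A
  mem_partitionsOfUnity : ∀ᵐ x ∂A, x ∈ partitionsOfUnity
  selfSimilar :
    A = ((volume.restrict (Set.Icc (0 : ℝ) 1)).prod (B.prod A)).map
      fun p => stickMerge p.1 p.2.1 p.2.2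

/-- The distance `‖x - y‖_∞`. -/
def distLinf (x y : ℕ → ℝ) : ℝ≥0∞ := ⨆ i, ENNReal.ofReal |x i - y i|

/-- The distance `‖x - y‖_1`. -/
def distL1 (x y : ℕ → ℝ) : ℝ≥0∞ := ∑' i, ENNReal.ofReal |x i - y i|

/-- The Wasserstein (transport) distance with cost `ρ` between two laws: the infimum of
`𝔼 ρ(X, Y)` over all couplings `(X, Y)`. -/
def wasserstein (ρ : (ℕ → ℝ) → (ℕ → ℝ) → ℝ≥0∞) (μ ν : Measure (ℕ → ℝ)) : ℝ≥0∞ :=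
  ⨅ (π : Measure ((ℕ → ℝ) × (ℕ → ℝ))) (_ : π.fst = μ ∧ π.snd = ν), ∫⁻ p, ρ p.1 p.2 ∂π

end BlockPerm

end

/-!
Why the theorem is true.

**Recursion for the cycles.** For a uniformly random element of `Γ ^ n ⋊ S_n`, the cycle of blocks
through a fixed block has a uniformly distributed length `L ∈ {1, …, n}`, the product of the labels
along it is uniform in `Γ`, and the rest is a uniformly random element of `Γ ^ (n - L) ⋊ S_(n - L)`.
So the cycle partition `C_n` of total mass `n` satisfies `C_n = (L ℬ, C_(n - L))` in distribution,
a discrete version of the equation for `𝒜` (`lintegral_blockLaw_recursion`). This is proved one block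
at a time: a distinguished block is either fixed, or it can be contracted into its image, which then
becomes the distinguished block and inherits its weight (`blockPartition_some`,
`blockSum_distinguished`).

**Existence and uniqueness of the law of `𝒜`.** For existence (`exists_isStickLaw`), break a stick
infinitely often with independent `U_j` and divide the `j`-th part according to `ℬ_j`; no mass is lost
because the expected total mass `M` satisfies `M = 1 / 2 + M / 2`. For uniqueness
(`IsStickLaw.unique`), feeding a coupling of two solutions with the same `U` and `ℬ` halves the
expected uniform distance.

**Coupling.** Let a stick of length `s` shrink to the lengths `s = s₀ > s₁ > …`, where `s_(j+1)` is
uniform on `[0, s_j]`. The part `s_j - s_(j+1)` is divided according to `ℬ_j`, which gives `s 𝒜`. The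
integer part of `s_(j+1)`, conditioned to differ from `r = ⌊s_j⌋`, is uniform on `{0, …, r - 1}`
(`lintegral_floor`). So if the parts `⌊s_j⌋ - ⌊s_(j+1)⌋` are divided by the same `ℬ_j`, the result is
distributed like `C_⌊s⌋` (`IsBlockCoupling.step`). No piece is changed by more than `1` in this
rounding, which gives the bound `1 / n` after rescaling from `s = n`. For the `ℓ¹` distance, a step
costs at most `min 1 s`, and the function `potential s = (5 / 2) log (1 + 4 s)` decreases by at least
that much in expectation (`min_add_integral_potential_le`); it is at most
`3 (log n + γ) + O(1 / n)` at `s = n`.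

The infinite process is avoided: `N` steps are taken, starting from the independent coupling, and
each step halves the expected stick length, so the error of the initial coupling contributes at most
`2 s / 2 ^ N` (`exists_isBlockCoupling`), and `N` is arbitrary.

Statements about decreasing rearrangements reduce to counting the members of a family above each
level (`lt_sortDesc_iff`).
-/

noncomputable section

namespace BlockPerm

/-! ### Decreasing rearrangements -/

section Sorting
variable {ι κ : Type*}

lemma natCast_lt_encard_iff (S : Set ι) (k : ℕ) :
    (k : ℕ∞) < S.encard ↔ ∃ s : Finset ι, s.card = k + 1 ∧ ↑s ⊆ S := by
  constructor
  · intro h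
    have h' : ((k + 1 : ℕ) : ℕ∞) ≤ S.encard := by
      push_cast; exact Order.add_one_le_of_lt h
    obtain ⟨s, hs, hsc⟩ := Set.exists_subset_encard_eq h'
    have hfin : s.Finite := Set.finite_of_encard_eq_coe hsc
    refine ⟨hfin.toFinset, ?_, by simpa using hs⟩
    rw [hfin.encard_eq_coe_toFinset_card] at hsc
    exact_mod_cast hsc
  · rintro ⟨s, hs, hsub⟩
    have := Set.encard_le_encard hsub
    rw [Set.encard_coe_eq_coe_finsetCard, hs] at this
    exact lt_of_lt_of_le (by exact_mod_cast Nat.lt_succ_self k) this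

/-- The rearrangement of a family depends only on the numbers of members exceeding each level. -/
lemma sortDesc_congr {x : ι → ℝ} {y : κ → ℝ}
    (h : ∀ t, 0 ≤ t → {i | t < x i}.encard = {i | t < y i}.encard) : sortDesc x = sortDesc y := by
  funext k
  unfold sortDesc
  congr 1
  ext t
  simp only [Set.mem_ofPred_eq]
  exact and_congr_right fun ht => by rw [h t ht]

/-- The sequence `sortDesc x` and the numbers of members exceeding the levels determine each other.
Boundedness excludes the junk value `sInf ∅ = 0` that `sortDesc` takes if infinitely many members
exceed every level. -/
lemma lt_sortDesc_iff {x : ι → ℝ} (hx : BddAbove (Set.range x)) {t : ℝ} (ht : 0 ≤ t) (k : ℕ) :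
    t < sortDesc x k ↔ (k : ℕ∞) < {i | t < x i}.encard := by
  have hbdd : BddBelow {t : ℝ | 0 ≤ t ∧ {i | t < x i}.encard ≤ k} := ⟨0, fun a ha => ha.1⟩
  constructor
  · intro h
    by_contra hk
    exact absurd (csInf_le hbdd ⟨ht, not_lt.1 hk⟩) (not_le.2 h)
  · intro h
    obtain ⟨b, hb⟩ := hx
    have hne : {t : ℝ | 0 ≤ t ∧ {i | t < x i}.encard ≤ k}.Nonempty := by
      refine ⟨max b 0, le_max_right _ _, ?_⟩
      have : {i | max b 0 < x i} = ∅ := by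
        ext i
        simpa using fun h1 : b < x i => absurd (hb ⟨i, rfl⟩) (not_le.2 h1)
      rw [this]; simp
    -- `k + 1` members exceed `t`, hence they exceed some `t' > t` as well.
    obtain ⟨s, hsc, hs⟩ := (natCast_lt_encard_iff _ k).1 h
    have hsne : s.Nonempty := Finset.card_pos.1 (by omega)
    obtain ⟨i₀, hi₀, hmin⟩ := s.exists_min_image x hsne
    refine lt_of_lt_of_le (hs hi₀) (le_csInf hne ?_)
    rintro a ⟨ha0, ha⟩
    by_contra hlt
    exact absurd ((natCast_lt_encard_iff _ k).2 ⟨s, hsc, fun i hi =>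
      (not_le.1 hlt).trans_le (hmin i hi)⟩) (not_lt.2 ha)

lemma sortDesc_nonneg (x : ι → ℝ) (k : ℕ) : 0 ≤ sortDesc x k :=
  Real.sInf_nonneg fun _ h => h.1

lemma encard_lt_natCast (N : ℕ∞) : {k : ℕ | (k : ℕ∞) < N}.encard = N := by
  induction N using ENat.recTopCoe with
  | top => simp
  | coe n =>
    have : {k : ℕ | (k : ℕ∞) < (n : ℕ∞)} = ↑(Finset.range n) := by ext; simp
    rw [this, Set.encard_coe_eq_coe_finsetCard, Finset.card_range]

lemma encard_lt_sortDesc {x : ι → ℝ} (hx : BddAbove (Set.range x)) {t : ℝ} (ht : 0 ≤ t) :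
    {k | t < sortDesc x k}.encard = {i | t < x i}.encard := by
  simp only [lt_sortDesc_iff hx ht, encard_lt_natCast]

lemma antitone_sortDesc {x : ι → ℝ} (hx : BddAbove (Set.range x)) : Antitone (sortDesc x) := by
  intro a b hab
  refine le_of_forall_lt fun t ht => ?_
  rcases lt_or_ge t 0 with h0 | h0
  · exact h0.trans_le (sortDesc_nonneg x a)
  · rw [lt_sortDesc_iff hx h0] at ht ⊢
    exact lt_of_le_of_lt (by exact_mod_cast hab) ht

lemma bddAbove_range_of_antitone {a : ℕ → ℝ} (ha : Antitone a) : BddAbove (Set.range a) :=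
  ⟨a 0, by rintro _ ⟨i, rfl⟩; exact ha (Nat.zero_le i)⟩

/-- A nonincreasing nonnegative sequence is its own rearrangement. -/
lemma sortDesc_eq_self {a : ℕ → ℝ} (ha : Antitone a) (h0 : ∀ i, 0 ≤ a i) : sortDesc a = a := by
  have hb := bddAbove_range_of_antitone ha
  funext k
  have key : ∀ t, 0 ≤ t → (t < sortDesc a k ↔ t < a k) := by
    intro t ht
    rw [lt_sortDesc_iff hb ht]
    constructor
    · intro h
      by_contra hk
      have hsub : {i | t < a i} ⊆ ↑(Finset.range k) := by
        intro i hi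
        simp only [Finset.coe_range, Set.mem_Iio]
        by_contra hik
        exact hk (lt_of_lt_of_le hi (ha (not_lt.1 hik)))
      have := Set.encard_le_encard hsub
      rw [Set.encard_coe_eq_coe_finsetCard, Finset.card_range] at this
      exact absurd h (not_lt.2 this)
    · intro h
      have hsub : (↑(Finset.range (k + 1)) : Set ℕ) ⊆ {i | t < a i} := by
        intro i hi
        simp only [Finset.coe_range, Set.mem_Iio] at hi
        exact lt_of_lt_of_le h (ha (Nat.lt_succ_iff.1 hi))
      have := Set.encard_le_encard hsub
      rw [Set.encard_coe_eq_coe_finsetCard, Finset.card_range] at this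
      exact lt_of_lt_of_le (by exact_mod_cast Nat.lt_succ_self k) this
  apply le_antisymm
  · by_contra h
    exact lt_irrefl _ ((key _ (h0 k)).1 (not_le.1 h))
  · by_contra h
    exact lt_irrefl _ ((key _ (sortDesc_nonneg a k)).2 (not_le.1 h))

lemma encard_setOf_comp_equiv (e : κ ≃ ι) (p : ι → Prop) :
    {j | p (e j)}.encard = {i | p i}.encard :=
  Set.encard_preimage_of_bijective e.bijective {i | p i}

lemma sortDesc_comp_equiv (e : κ ≃ ι) (x : ι → ℝ) : sortDesc (x ∘ e) = sortDesc x :=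
  sortDesc_congr fun t _ => encard_setOf_comp_equiv e fun i => t < x i

lemma encard_sumElim (x : ι → ℝ) (y : κ → ℝ) (t : ℝ) :
    {i | t < Sum.elim x y i}.encard = {i | t < x i}.encard + {i | t < y i}.encard := by
  have : {i | t < Sum.elim x y i} = Sum.inl '' {i | t < x i} ∪ Sum.inr '' {i | t < y i} := by
    ext (i | i) <;> simp
  rw [this, Set.encard_union_eq, Sum.inl_injective.encard_image, Sum.inr_injective.encard_image]
  rw [Set.disjoint_left]
  rintro _ ⟨i, _, rfl⟩ ⟨j, _, hj⟩
  cases hj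

lemma encard_const_mul (x : ι → ℝ) {c t : ℝ} (hc : 0 < c) :
    {i | t < c * x i} = {i | t / c < x i} := by
  ext i; simp [div_lt_iff₀' hc]

lemma sortDesc_const_mul {x : ι → ℝ} (hx : BddAbove (Set.range x)) {c : ℝ} (hc : 0 ≤ c) :
    sortDesc (fun i => c * x i) = fun k => c * sortDesc x k := by
  rcases hc.eq_or_lt with rfl | hc
  · have h1 : sortDesc (fun _ : ι => (0 : ℝ)) = sortDesc (fun _ : ℕ => (0 : ℝ)) :=
      sortDesc_congr fun t ht => by simp [not_lt.2 ht]
    simp only [zero_mul]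
    rw [h1]
    exact sortDesc_eq_self (fun _ _ _ => le_rfl) fun _ => le_rfl
  · rw [← sortDesc_eq_self (a := fun k => c * sortDesc x k)
      (fun a b hab => mul_le_mul_of_nonneg_left (antitone_sortDesc hx hab) hc.le)
      (fun k => mul_nonneg hc.le (sortDesc_nonneg x k))]
    refine sortDesc_congr fun t ht => ?_
    rw [encard_const_mul _ hc, encard_const_mul _ hc, encard_lt_sortDesc hx (by positivity)]

lemma encard_const_mul_sortDesc {x : ι → ℝ} (hx : BddAbove (Set.range x)) {c t : ℝ} (hc : 0 ≤ c)
    (ht : 0 ≤ t) : {k | t < c * sortDesc x k}.encard = {i | t < c * x i}.encard := by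
  rcases hc.eq_or_lt with rfl | hc
  · simp [not_lt.2 ht]
  · rw [encard_const_mul _ hc, encard_const_mul _ hc, encard_lt_sortDesc hx (by positivity)]

/-- Sorting two families does not increase their uniform distance. -/
lemma sortDesc_lipschitz {x y : ι → ℝ} (hx : BddAbove (Set.range x)) (hy : BddAbove (Set.range y))
    {ε : ℝ} (h : ∀ i, |x i - y i| ≤ ε) (k : ℕ) (hε : 0 ≤ ε) :
    |sortDesc x k - sortDesc y k| ≤ ε := by
  have key : ∀ {x y : ι → ℝ}, BddAbove (Set.range x) → BddAbove (Set.range y) →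
      (∀ i, x i ≤ y i + ε) → sortDesc x k ≤ sortDesc y k + ε := by
    intro x y hx hy h
    by_contra hlt
    have h0 := sortDesc_nonneg y k
    have h1 := (lt_sortDesc_iff hx (by positivity) k).1 (not_le.1 hlt)
    have h2 : {i | sortDesc y k + ε < x i} ⊆ {i | sortDesc y k < y i} := by
      intro i hi
      have := h i
      simp only [Set.mem_ofPred_eq] at hi ⊢
      linarith
    exact lt_irrefl _ ((lt_sortDesc_iff hy h0 k).2 (h1.trans_le (Set.encard_le_encard h2)))
  have h1 := key hx hy fun i => by have := abs_le.1 (h i); linarith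
  have h2 := key hy hx fun i => by have := abs_le.1 (h i); linarith
  rw [abs_le]; constructor <;> linarith

end Sorting

section L1
variable {ι κ : Type*}

lemma setOf_not_lt_iff_lt (a b : ℝ) :
    {t : ℝ | ¬(t < a ↔ t < b)} = Set.Ico (min a b) (max a b) := by
  ext t
  simp only [Set.mem_ofPred_eq, Set.mem_Ico, min_le_iff, lt_max_iff]
  rw [← not_lt, ← not_lt]
  tauto

/-- Layer-cake formula for the `ℓ¹` distance of two nonnegative families. -/
lemma tsum_ofReal_abs_sub [Countable ι] {x y : ι → ℝ} (hx : ∀ i, 0 ≤ x i) (hy : ∀ i, 0 ≤ y i) :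
    ∑' i, ENNReal.ofReal |x i - y i|
      = ∫⁻ t in Set.Ici (0 : ℝ), ({i | ¬(t < x i ↔ t < y i)}.encard : ℝ≥0∞) := by
  have h1 : ∀ i, ENNReal.ofReal |x i - y i|
      = ∫⁻ t in Set.Ici (0 : ℝ), {t : ℝ | ¬(t < x i ↔ t < y i)}.indicator 1 t := by
    intro i
    have hsub : Set.Ico (min (x i) (y i)) (max (x i) (y i)) ⊆ Set.Ici 0 :=
      fun t ht => (le_min (hx i) (hy i)).trans ht.1
    rw [setOf_not_lt_iff_lt, lintegral_indicator_one measurableSet_Ico,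
      Measure.restrict_apply measurableSet_Ico, Set.inter_eq_left.2 hsub, Real.volume_Ico,
      max_sub_min_eq_abs']
  simp_rw [h1]
  rw [← lintegral_tsum]
  · refine lintegral_congr fun t => ?_
    rw [← ENNReal.tsum_set_one, tsum_subtype {i | ¬(t < x i ↔ t < y i)} fun _ => (1 : ℝ≥0∞)]
    rfl
  · intro i
    refine (measurable_one.indicator ?_).aemeasurable
    rw [setOf_not_lt_iff_lt]; exact measurableSet_Ico

lemma tsum_ofReal_sortDesc [Countable ι] {x : ι → ℝ} (hx : BddAbove (Set.range x))
    (h0 : ∀ i, 0 ≤ x i) :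
    ∑' k, ENNReal.ofReal (sortDesc x k) = ∑' i, ENNReal.ofReal (x i) := by
  have h1 := tsum_ofReal_abs_sub (y := fun _ => 0) h0 fun _ => le_rfl
  have h2 := tsum_ofReal_abs_sub (y := fun _ => 0) (sortDesc_nonneg x) fun _ => le_rfl
  simp only [sub_zero, abs_of_nonneg (h0 _), abs_of_nonneg (sortDesc_nonneg x _)] at h1 h2
  rw [h1, h2]
  refine setLIntegral_congr_fun measurableSet_Ici fun t ht => ?_
  simp only [not_lt.2 (Set.mem_Ici.1 ht), iff_false, not_not]
  rw [encard_lt_sortDesc hx ht]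

/-- Two initial segments of `ℕ` differ in as many points as their cardinalities do, so sorting can
only decrease the number of indices that separate the two families at the level `t`. -/
lemma encard_not_iff_sortDesc_le {x y : ι → ℝ} (hx : BddAbove (Set.range x))
    (hy : BddAbove (Set.range y)) {t : ℝ} (ht : 0 ≤ t) :
    {k | ¬(t < sortDesc x k ↔ t < sortDesc y k)}.encard ≤ {i | ¬(t < x i ↔ t < y i)}.encard := by
  wlog hle : {i | t < x i}.encard ≤ {i | t < y i}.encard generalizing x y
  · have := this hy hx (le_of_not_ge hle)
    simpa only [iff_comm] using this
  simp only [lt_sortDesc_iff hx ht, lt_sortDesc_iff hy ht]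
  have hsub : {i | t < y i} ⊆ {i | t < x i} ∪ {i | ¬(t < x i ↔ t < y i)} := by
    intro i hi
    simp only [Set.mem_ofPred_eq, Set.mem_union] at hi ⊢
    tauto
  have hN := (Set.encard_le_encard hsub).trans (Set.encard_union_le _ _)
  generalize {i | t < x i}.encard = a at *
  generalize {i | t < y i}.encard = b at *
  generalize {i | ¬(t < x i ↔ t < y i)}.encard = d at *
  have hD : Disjoint {k : ℕ | (k : ℕ∞) < a} {k : ℕ | ¬((k : ℕ∞) < a ↔ (k : ℕ∞) < b)} := by
    rw [Set.disjoint_left]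
    intro k hk hk'
    exact hk' ⟨fun _ => lt_of_lt_of_le hk hle, fun _ => hk⟩
  have hU : {k : ℕ | (k : ℕ∞) < a} ∪ {k : ℕ | ¬((k : ℕ∞) < a ↔ (k : ℕ∞) < b)}
      = {k : ℕ | (k : ℕ∞) < b} := by
    ext k
    simp only [Set.mem_ofPred_eq, Set.mem_union]
    have : (k : ℕ∞) < a → (k : ℕ∞) < b := fun h => lt_of_lt_of_le h hle
    tauto
  have hsum := Set.encard_union_eq hD
  rw [hU, encard_lt_natCast, encard_lt_natCast] at hsum
  rcases eq_or_ne a ⊤ with rfl | ha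
  · have hb : b = ⊤ := top_le_iff.1 hle
    subst hb
    simp
  · rw [hsum] at hN
    exact (ENat.add_le_add_iff_left ha).1 hN

/-- Sorting two families does not increase their `ℓ¹` distance. -/
lemma tsum_abs_sortDesc_sub_le [Countable ι] {x y : ι → ℝ} (hx : BddAbove (Set.range x))
    (hy : BddAbove (Set.range y)) (hx0 : ∀ i, 0 ≤ x i) (hy0 : ∀ i, 0 ≤ y i) :
    ∑' k, ENNReal.ofReal |sortDesc x k - sortDesc y k| ≤ ∑' i, ENNReal.ofReal |x i - y i| := by
  rw [tsum_ofReal_abs_sub hx0 hy0, tsum_ofReal_abs_sub (sortDesc_nonneg x) (sortDesc_nonneg y)]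
  refine setLIntegral_mono' measurableSet_Ici fun t ht => ?_
  exact ENat.toENNReal_le.2 (encard_not_iff_sortDesc_le hx hy ht)

end L1

section Measurability
variable {ι Ω : Type*} [MeasurableSpace Ω]

lemma measurableSet_encard_le [Countable ι] {X : Ω → ι → ℝ}
    (hX : ∀ i, Measurable fun ω => X ω i) (t : ℝ) (k : ℕ) :
    MeasurableSet {ω | {i | t < X ω i}.encard ≤ (k : ℕ∞)} := by
  have : {ω | {i | t < X ω i}.encard ≤ (k : ℕ∞)}
      = (⋃ s ∈ {s : Finset ι | s.card = k + 1}, ⋂ i ∈ s, {ω | t < X ω i})ᶜ := by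
    ext ω
    rw [Set.mem_ofPred_eq, ← not_lt, natCast_lt_encard_iff, Set.mem_compl_iff, not_iff_not]
    simp only [Set.mem_iUnion, Set.mem_iInter, exists_prop, Set.subset_def, Finset.mem_coe]
    rfl
  rw [this]
  refine (MeasurableSet.biUnion (Set.to_countable _) fun s _ => ?_).compl
  exact Finset.measurableSet_biInter _ fun i _ => measurableSet_lt measurable_const (hX i)

/-- A countable description of the sublevel sets of `sortDesc`; the second alternative accounts for
the value `sInf ∅ = 0`. -/
lemma sortDesc_lt_iff {ι : Type*} (x : ι → ℝ) (k : ℕ) (c : ℝ) :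
    sortDesc x k < c ↔ (∃ q : ℚ, 0 ≤ q ∧ (q : ℝ) < c ∧ {i | (q : ℝ) < x i}.encard ≤ (k : ℕ∞)) ∨
      ((∀ q : ℚ, 0 ≤ q → ¬ {i | (q : ℝ) < x i}.encard ≤ (k : ℕ∞)) ∧ 0 < c) := by
  have hmono : ∀ {t q : ℝ}, t ≤ q → {i | t < x i}.encard ≤ (k : ℕ∞) →
      {i | q < x i}.encard ≤ (k : ℕ∞) := fun h h' =>
    (Set.encard_le_encard fun i hi => lt_of_le_of_lt h hi).trans h'
  have hbdd : BddBelow {t : ℝ | 0 ≤ t ∧ {i | t < x i}.encard ≤ k} := ⟨0, fun a ha => ha.1⟩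
  by_cases hne : {t : ℝ | 0 ≤ t ∧ {i | t < x i}.encard ≤ k}.Nonempty
  · have h2 : ¬ ∀ q : ℚ, 0 ≤ q → ¬ {i | (q : ℝ) < x i}.encard ≤ (k : ℕ∞) := by
      obtain ⟨t, ht0, ht⟩ := hne
      obtain ⟨q, hq⟩ := exists_rat_gt t
      exact fun h => h q (by exact_mod_cast ht0.trans hq.le) (hmono hq.le ht)
    simp only [h2, false_and, or_false]
    unfold sortDesc
    rw [csInf_lt_iff hbdd hne]
    constructor
    · rintro ⟨t, ⟨ht0, ht⟩, htc⟩
      obtain ⟨q, hq, hqc⟩ := exists_rat_btwn htc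
      exact ⟨q, by exact_mod_cast ht0.trans hq.le, hqc, hmono hq.le ht⟩
    · rintro ⟨q, hq0, hqc, hq⟩
      exact ⟨q, ⟨by exact_mod_cast hq0, hq⟩, hqc⟩
  · have h2 : ∀ q : ℚ, 0 ≤ q → ¬ {i | (q : ℝ) < x i}.encard ≤ (k : ℕ∞) :=
      fun q hq hk => hne ⟨q, by exact_mod_cast hq, hk⟩
    have h3 : sortDesc x k = 0 := by
      unfold sortDesc
      rw [Set.not_nonempty_iff_eq_empty.1 hne, Real.sInf_empty]
    rw [h3]
    constructor
    · exact fun h => Or.inr ⟨h2, h⟩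
    · rintro (⟨q, hq0, -, hq⟩ | h)
      · exact absurd hq (h2 q hq0)
      · exact h.2

lemma measurable_sortDesc [Countable ι] {X : Ω → ι → ℝ} (hX : ∀ i, Measurable fun ω => X ω i) :
    Measurable fun ω => sortDesc (X ω) := by
  refine measurable_pi_lambda _ fun k => measurable_of_Iio fun c => ?_
  have hm := fun q : ℚ => measurableSet_encard_le hX (q : ℝ) k
  have : (fun ω => sortDesc (X ω) k) ⁻¹' Set.Iio c
      = {ω | (∃ q : ℚ, 0 ≤ q ∧ (q : ℝ) < c ∧ {i | (q : ℝ) < X ω i}.encard ≤ (k : ℕ∞)) ∨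
        ((∀ q : ℚ, 0 ≤ q → ¬ {i | (q : ℝ) < X ω i}.encard ≤ (k : ℕ∞)) ∧ 0 < c)} := by
    ext ω
    exact sortDesc_lt_iff _ _ _
  rw [this]
  have hm' := fun q : ℚ => measurableSet_setOfPred.1 (hm q)
  exact measurableSet_setOfPred.2 <|
    .or (.exists fun q => .and measurable_const (.and measurable_const (hm' q)))
      (.and (.forall fun q => .imp measurable_const (hm' q).not) measurable_const)

end Measurability

/-! ### Weighted cycle partitions and the contraction of a block -/

section Merge

/-- The decreasing rearrangement of the disjoint union of two sequences. -/
def merge (x y : ℕ → ℝ) : ℕ → ℝ := sortDesc (Sum.elim x y : ℕ ⊕ ℕ → ℝ)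

lemma stickMerge_eq_merge (u : ℝ) (b a : ℕ → ℝ) :
    stickMerge u b a = merge (fun i => u * b i) (fun i => (1 - u) * a i) := rfl

lemma bddAbove_range_sumElim {ι κ : Type*} {x : ι → ℝ} {y : κ → ℝ} (hx : BddAbove (Set.range x))
    (hy : BddAbove (Set.range y)) : BddAbove (Set.range (Sum.elim x y)) := by
  rw [Set.Sum.elim_range]; exact hx.union hy

lemma merge_sortDesc {ι κ : Type*} {x : ι → ℝ} {y : κ → ℝ} (hx : BddAbove (Set.range x))
    (hy : BddAbove (Set.range y)) :
    merge (sortDesc x) (sortDesc y) = sortDesc (Sum.elim x y) :=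
  sortDesc_congr fun t ht => by
    rw [encard_sumElim, encard_sumElim, encard_lt_sortDesc hx ht, encard_lt_sortDesc hy ht]

end Merge

section WeightedCycles
open Classical

variable {X Y : Type*} [Fintype X] [Fintype Y]

/-- The total weight of each cycle of `σ`, where the point `a` weighs `w a`. -/
def cycleWeight (σ : Equiv.Perm X) (w : X → ℝ) (c : Cycles σ) : ℝ :=
  ∑ a, if (Quotient.mk _ a : Cycles σ) = c then w a else 0

/-- The total weights of the cycles of `σ`, in nonincreasing order. -/
def weightPartition (σ : Equiv.Perm X) (w : X → ℝ) : ℕ → ℝ := sortDesc (cycleWeight σ w)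

lemma bddAbove_cycleWeight (σ : Equiv.Perm X) (w : X → ℝ) :
    BddAbove (Set.range (cycleWeight σ w)) :=
  (Set.finite_range _).bddAbove

lemma cyclePartition_eq (σ : Equiv.Perm X) :
    cyclePartition σ = weightPartition σ fun _ => 1 / (Nat.card X : ℝ) := by
  unfold cyclePartition weightPartition
  congr 1
  funext c
  simp only [cycleWeight, cycleLength]
  rw [← Finset.sum_filter, Finset.sum_const, Nat.card_eq_fintype_card, Fintype.card_subtype,
    nsmul_eq_mul, mul_one_div]

lemma weightPartition_const_mul (σ : Equiv.Perm X) (w : X → ℝ) {c : ℝ} (hc : 0 ≤ c) :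
    weightPartition σ (fun a => c * w a) = fun k => c * weightPartition σ w k := by
  unfold weightPartition
  rw [← sortDesc_const_mul (bddAbove_cycleWeight σ w) hc]
  congr 1
  funext q
  simp only [cycleWeight, Finset.mul_sum, mul_ite, mul_zero]

lemma sameCycle_induction {σ : Equiv.Perm X} {r : X → X → Prop} (hr : Equivalence r)
    (h : ∀ x, r x (σ x)) {x y : X} (hxy : σ.SameCycle x y) : r x y := by
  obtain ⟨n, hn⟩ := hxy.exists_nat_pow_eq
  subst hn
  clear hxy
  induction n with
  | zero => simpa using hr.refl x
  | succ n ih => rw [pow_succ', Equiv.Perm.mul_apply]; exact hr.trans ih (h _)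

/-- If `f`, with right inverse `s`, maps the cycles of `σ` bijectively to the cycles of `τ`, then the
weighted cycle partitions of `σ` and `τ` agree, for weights transported along `f`. -/
lemma weightPartition_eq_of_semiconj {σ : Equiv.Perm X} {τ : Equiv.Perm Y} (f : X → Y) (s : Y → X)
    (hfs : ∀ y, f (s y) = y) (h1 : ∀ x, σ.SameCycle x (s (f x)))
    (h2 : ∀ y, σ.SameCycle (s y) (s (τ y))) (h3 : ∀ x, τ.SameCycle (f x) (f (σ x)))
    (w : X → ℝ) : weightPartition σ w
      = weightPartition τ fun y => ∑ x, if f x = y then w x else 0 := by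
  have hf : ∀ x x', σ.SameCycle x x' ↔ τ.SameCycle (f x) (f x') := by
    intro x x'
    constructor
    · exact sameCycle_induction (r := fun x x' => τ.SameCycle (f x) (f x'))
        ⟨fun _ => .refl _ _, fun h => h.symm, fun h h' => h.trans h'⟩ h3
    · intro h
      have := sameCycle_induction (r := fun y y' => σ.SameCycle (s y) (s y'))
        ⟨fun _ => .refl _ _, fun h => h.symm, fun h h' => h.trans h'⟩ h2 h
      exact (h1 x).trans (this.trans (h1 x').symm)
  let e : Cycles σ ≃ Cycles τ :=
    { toFun := Quotient.map f fun x x' h => (hf x x').1 h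
      invFun := Quotient.map s fun y y' h => (hf _ _).2 (by rw [hfs, hfs]; exact h)
      left_inv := by
        rintro ⟨x⟩
        exact Quotient.sound (h1 x).symm
      right_inv := by
        rintro ⟨y⟩
        exact congrArg (Quotient.mk _) (hfs y) }
  unfold weightPartition
  rw [← sortDesc_comp_equiv e]
  congr 1
  funext c
  simp only [Function.comp, cycleWeight]
  have hswap : ∀ y, (if (Quotient.mk _ y : Cycles τ) = e c then
      ∑ x, if f x = y then w x else 0 else 0)
      = ∑ x, if f x = y ∧ (Quotient.mk _ y : Cycles τ) = e c then w x else 0 := by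
    intro y
    by_cases h : (Quotient.mk _ y : Cycles τ) = e c <;> simp [h]
  simp_rw [hswap]
  rw [Finset.sum_comm]
  refine Finset.sum_congr rfl fun x _ => ?_
  have hx : (Quotient.mk _ (f x) : Cycles τ) = e c ↔ (Quotient.mk _ x : Cycles σ) = c := by
    rw [show (Quotient.mk _ (f x) : Cycles τ) = e (Quotient.mk _ x) from rfl, e.apply_eq_iff_eq]
  rw [Finset.sum_eq_single (f x)]
  · simp [hx]
  · intro y _ hy
    rw [if_neg fun h => hy h.1.symm]
  · simp

lemma sameCycle_apply_self {X : Type*} (σ : Equiv.Perm X) (x : X) : σ.SameCycle x (σ x) :=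
  Equiv.Perm.sameCycle_apply_right.2 (.refl _ _)

lemma weightPartition_conj (e : X ≃ Y) (σ : Equiv.Perm X) (τ : Equiv.Perm Y)
    (h : ∀ x, e (σ x) = τ (e x)) (w : Y → ℝ) :
    weightPartition σ (fun x => w (e x)) = weightPartition τ w := by
  rw [weightPartition_eq_of_semiconj (τ := τ) e e.symm (fun y => by simp)
    (fun x => by simpa using Equiv.Perm.SameCycle.refl _ _) (fun y => ?_) (fun x => ?_)]
  · congr 1
    funext y
    rw [Finset.sum_eq_single (e.symm y)]
    · simp
    · intro x _ hx
      rw [if_neg]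
      rintro rfl
      simp at hx
    · simp
  · rw [show e.symm (τ y) = σ (e.symm y) from e.injective (by rw [h]; simp)]
    exact sameCycle_apply_self _ _
  · rw [h]; exact sameCycle_apply_self _ _

lemma sameCycle_sumCongr_inl (σ : Equiv.Perm X) (τ : Equiv.Perm Y) (x x' : X) :
    (Equiv.Perm.sumCongr σ τ).SameCycle (.inl x) (.inl x') ↔ σ.SameCycle x x' := by
  constructor
  · intro h
    obtain ⟨n, hn⟩ := h.exists_nat_pow_eq
    refine ⟨n, ?_⟩
    have : ∀ n : ℕ, ((Equiv.Perm.sumCongr σ τ) ^ n) (.inl x) = .inl ((σ ^ n) x) := by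
      intro n
      induction n with
      | zero => rfl
      | succ n ih => rw [pow_succ', Equiv.Perm.mul_apply, ih, pow_succ']; rfl
    rw [this] at hn
    simpa using hn
  · exact sameCycle_induction (r := fun x x' => (Equiv.Perm.sumCongr σ τ).SameCycle (.inl x) (.inl x'))
        ⟨fun _ => .refl _ _, fun h => h.symm, fun h h' => h.trans h'⟩
        fun x => sameCycle_apply_self (Equiv.Perm.sumCongr σ τ) (.inl x)

lemma sameCycle_sumCongr_inr (σ : Equiv.Perm X) (τ : Equiv.Perm Y) (y y' : Y) :
    (Equiv.Perm.sumCongr σ τ).SameCycle (.inr y) (.inr y') ↔ τ.SameCycle y y' := by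
  constructor
  · intro h
    obtain ⟨n, hn⟩ := h.exists_nat_pow_eq
    refine ⟨n, ?_⟩
    have : ∀ n : ℕ, ((Equiv.Perm.sumCongr σ τ) ^ n) (.inr y) = .inr ((τ ^ n) y) := by
      intro n
      induction n with
      | zero => rfl
      | succ n ih => rw [pow_succ', Equiv.Perm.mul_apply, ih, pow_succ']; rfl
    rw [this] at hn
    simpa using hn
  · exact sameCycle_induction (r := fun x x' => (Equiv.Perm.sumCongr σ τ).SameCycle (.inr x) (.inr x'))
        ⟨fun _ => .refl _ _, fun h => h.symm, fun h h' => h.trans h'⟩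
        fun x => sameCycle_apply_self (Equiv.Perm.sumCongr σ τ) (.inr x)

lemma weightPartition_sumCongr (σ : Equiv.Perm X) (τ : Equiv.Perm Y) (w : X ⊕ Y → ℝ) :
    weightPartition (Equiv.Perm.sumCongr σ τ) w
      = merge (weightPartition σ fun x => w (.inl x)) (weightPartition τ fun y => w (.inr y)) := by
  unfold weightPartition
  rw [merge_sortDesc (bddAbove_cycleWeight _ _) (bddAbove_cycleWeight _ _)]
  have hside : ∀ p q, (Equiv.Perm.sumCongr σ τ).SameCycle p q → Sum.isLeft p = Sum.isLeft q := by
    intro p q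
    refine sameCycle_induction (r := fun p q : X ⊕ Y => Sum.isLeft p = Sum.isLeft q)
      ⟨fun _ => rfl, fun h => h.symm, fun h h' => h.trans h'⟩ ?_
    rintro (x | y) <;> rfl
  let φ : Cycles σ ⊕ Cycles τ → Cycles (Equiv.Perm.sumCongr σ τ) :=
    Sum.elim
      (Quotient.map Sum.inl fun x x' h => (sameCycle_sumCongr_inl σ τ x x').2 h)
      (Quotient.map Sum.inr fun x x' h => (sameCycle_sumCongr_inr σ τ x x').2 h)
  have hφ : Function.Bijective φ := by
    constructor
    · rintro (c | c) (c' | c') h <;> obtain ⟨x, rfl⟩ := Quotient.exists_rep c <;>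
        obtain ⟨x', rfl⟩ := Quotient.exists_rep c'
      · exact congrArg Sum.inl
          (Quotient.sound ((sameCycle_sumCongr_inl σ τ x x').1 (Quotient.exact h)))
      · exact absurd (hside _ _ (Quotient.exact h)) (by simp)
      · exact absurd (hside _ _ (Quotient.exact h)) (by simp)
      · exact congrArg Sum.inr
          (Quotient.sound ((sameCycle_sumCongr_inr σ τ x x').1 (Quotient.exact h)))
    · rintro ⟨x | y⟩
      · exact ⟨.inl (Quotient.mk _ x), rfl⟩
      · exact ⟨.inr (Quotient.mk _ y), rfl⟩
  rw [← sortDesc_comp_equiv (Equiv.ofBijective φ hφ)]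
  congr 1
  funext c
  simp only [Function.comp, Equiv.ofBijective_apply, cycleWeight, Fintype.sum_sum_type]
  have hl : ∀ x c, (Quotient.mk _ (Sum.inl x) : Cycles (Equiv.Perm.sumCongr σ τ)) = φ c
      ↔ Sum.inl (Quotient.mk _ x) = c := fun x c => by
    rw [← hφ.injective.eq_iff]; rfl
  have hr : ∀ y c, (Quotient.mk _ (Sum.inr y) : Cycles (Equiv.Perm.sumCongr σ τ)) = φ c
      ↔ Sum.inr (Quotient.mk _ y) = c := fun x c => by
    rw [← hφ.injective.eq_iff]; rfl
  simp only [hl, hr]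
  rcases c with c | c <;> simp [cycleWeight]

end WeightedCycles

section Blocks
open Classical
variable {m : ℕ} {α β : Type} [Fintype α] [Fintype β]

/-- The permutation of the blocks `{i} × Fin m` by `h`, followed by `g i` inside the block `i`. -/
def blockPerm (g : α → Equiv.Perm (Fin m)) (h : Equiv.Perm α) : Equiv.Perm (α × Fin m) where
  toFun p := (h p.1, g (h p.1) p.2)
  invFun p := (h⁻¹ p.1, (g p.1)⁻¹ p.2)
  left_inv p := by simp
  right_inv p := by simp

lemma blockPerm_apply {α : Type} (g : α → Equiv.Perm (Fin m)) (h : Equiv.Perm α) (i : α) (a : Fin m) :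
    blockPerm g h (i, a) = (h i, g (h i) a) := rfl

/-- The partition given by a block permutation when each point of the block `i` weighs `w i`. -/
def blockPartition (g : α → Equiv.Perm (Fin m)) (h : Equiv.Perm α) (w : α → ℝ) : ℕ → ℝ :=
  weightPartition (blockPerm g h) fun p => w p.1

lemma blockPartition_none (b : Equiv.Perm (Fin m)) (g : α → Equiv.Perm (Fin m))
    (τ : Equiv.Perm α) (w : Option α → ℝ) :
    blockPartition (fun i => i.elim b g) (Equiv.Perm.decomposeOption.symm (none, τ)) w
      = merge (weightPartition b fun _ => w none) (blockPartition g τ fun i => w (some i)) := by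
  let e : Fin m ⊕ (α × Fin m) ≃ Option α × Fin m :=
    { toFun := Sum.elim (fun a => (none, a)) (fun p => (some p.1, p.2))
      invFun := fun p => p.1.elim (.inl p.2) (fun i => .inr (i, p.2))
      left_inv := by rintro (a | ⟨i, a⟩) <;> rfl
      right_inv := by rintro ⟨_ | i, a⟩ <;> rfl }
  unfold blockPartition
  rw [← weightPartition_conj e (Equiv.Perm.sumCongr b (blockPerm g τ)), weightPartition_sumCongr]
  · rfl
  · rintro (a | ⟨i, a⟩)
    · simp [e, blockPerm_apply]
    · simp [e, blockPerm_apply]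

/-- Contracting a block that is not fixed: it is merged with its image `x₀`. -/
lemma blockPartition_some (b : Equiv.Perm (Fin m)) (g : α → Equiv.Perm (Fin m))
    (τ : Equiv.Perm α) (x₀ : α) (w : Option α → ℝ) :
    blockPartition (fun i => i.elim b g) (Equiv.Perm.decomposeOption.symm (some x₀, τ)) w
      = blockPartition (g * Pi.mulSingle x₀ b) τ
          fun i => w (some i) + if i = x₀ then w none else 0 := by
  unfold blockPartition
  set h := Equiv.Perm.decomposeOption.symm (some x₀, τ) with hh
  have h_none : h none = some x₀ := by simp [hh]
  have h_some : ∀ i, h (some i) = if τ i = x₀ then none else some (τ i) := by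
    intro i
    simp only [hh, Equiv.Perm.decomposeOption_symm_apply, Equiv.Perm.mul_apply,
      Equiv.optionCongr_apply, Option.map_some]
    split_ifs with hi
    · rw [hi, Equiv.swap_apply_right]
    · exact Equiv.swap_apply_of_ne_of_ne (by simp) (by simpa using hi)
  set σ := blockPerm (fun i : Option α => i.elim b g) h with hσ
  set τ' := blockPerm (g * Pi.mulSingle x₀ b) τ with hτ'
  let f : Option α × Fin m → α × Fin m := fun p => p.1.elim (x₀, g x₀ p.2) fun i => (i, p.2)
  let s : α × Fin m → Option α × Fin m := fun p => (some p.1, p.2)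
  have hσn : ∀ a, σ (none, a) = s (f (none, a)) := by
    intro a
    simp [hσ, blockPerm_apply, h_none, s, f]
  have hσs : ∀ i a, τ i = x₀ → σ (some i, a) = (none, b a) := by
    intro i a hi
    simp [hσ, blockPerm_apply, h_some, hi]
  have hτs : ∀ i a, τ i = x₀ → τ' (i, a) = f (none, b a) := by
    intro i a hi
    simp [hτ', blockPerm_apply, hi, f]
  have hσs' : ∀ i a, τ i ≠ x₀ → σ (some i, a) = s (τ' (i, a)) := by
    intro i a hi
    simp [hσ, hτ', blockPerm_apply, h_some, hi, s]
  rw [weightPartition_eq_of_semiconj (τ := τ') f s (fun y => rfl)]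
  · congr 1
    funext ⟨i, c⟩
    rw [Fintype.sum_prod_type, Fintype.sum_option, add_comm]
    congr 1
    · rw [Finset.sum_eq_single i, Finset.sum_eq_single c] <;>
        simp +contextual [f, Prod.ext_iff]
    · by_cases hi : i = x₀
      · subst hi
        rw [Finset.sum_eq_single ((g i)⁻¹ c)]
        · simp [f]
        · intro a _ ha
          rw [if_neg]
          rintro ⟨⟩
          simp at ha
        · simp
      · simp [f, hi, Ne.symm hi, Prod.ext_iff]
  · rintro ⟨_ | i, a⟩
    · rw [← hσn]; exact sameCycle_apply_self _ _
    · exact .refl _ _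
  · rintro ⟨i, a⟩
    by_cases hi : τ i = x₀
    · rw [hτs i a hi, ← hσn, ← hσs i a hi]
      exact (sameCycle_apply_self σ _).trans (sameCycle_apply_self σ _)
    · rw [← hσs' i a hi]
      exact sameCycle_apply_self σ _
  · rintro ⟨_ | i, a⟩
    · rw [hσn]; exact .refl _ _
    · by_cases hi : τ i = x₀
      · rw [hσs i a hi, ← hτs i a hi]; exact sameCycle_apply_self _ _
      · rw [hσs' i a hi]; exact sameCycle_apply_self τ' _

lemma blockPartition_congr (e : α ≃ β) (g : β → Equiv.Perm (Fin m)) (h : Equiv.Perm β)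
    (w : β → ℝ) :
    blockPartition (g ∘ e) (e.permCongr.symm h) (w ∘ e) = blockPartition g h w := by
  refine weightPartition_conj (e.prodCongr (Equiv.refl _)) _ _ ?_ fun p : β × Fin m => w p.1
  rintro ⟨i, a⟩
  simp [blockPerm_apply]

variable (Γ : Subgroup (Equiv.Perm (Fin m)))

/-- The sum of `F` over the weighted cycle partitions of all block permutations. -/
def blockSum (α : Type) [Fintype α] (w : α → ℝ) (F : (ℕ → ℝ) → ℝ≥0∞) : ℝ≥0∞ :=
  ∑ g : α → Γ, ∑ h : Equiv.Perm α, F (blockPartition (fun i => (g i : Equiv.Perm (Fin m))) h w)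

lemma blockSum_congr (e : α ≃ β) (w : β → ℝ) (F : (ℕ → ℝ) → ℝ≥0∞) :
    blockSum Γ α (w ∘ e) F = blockSum Γ β w F := by
  unfold blockSum
  refine (Fintype.sum_equiv (e.arrowCongr (Equiv.refl Γ)).symm _ _ fun g => ?_).symm
  refine Fintype.sum_equiv e.permCongr.symm _ _ fun h => ?_
  rw [← blockPartition_congr e]
  rfl

/-- Conditioning on the image of a distinguished block: either the block is fixed, and contributes
the cycles of its own label, or it can be contracted into its image. -/
lemma blockSum_option (w : Option α → ℝ) (F : (ℕ → ℝ) → ℝ≥0∞) :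
    blockSum Γ (Option α) w F
      = ∑ b : Γ, blockSum Γ α (fun i => w (some i))
          (fun a => F (merge (weightPartition (b : Equiv.Perm (Fin m)) fun _ => w none) a))
        + Fintype.card Γ * ∑ x₀, blockSum Γ α
            (fun i => w (some i) + if i = x₀ then w none else 0) F := by
  have h0 : blockSum Γ (Option α) w F = ∑ g : Option α → Γ, ∑ h : Equiv.Perm (Option α),
      F (blockPartition (fun i => (g i : Equiv.Perm (Fin m))) h w) := by
    -- the two sides differ in the decidability instances on `Option α`
    unfold blockSum
    convert rfl
  rw [h0]
  unfold blockSum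
  rw [Fintype.sum_equiv (Equiv.piOptionEquivProd (β := fun _ => Γ)) _
    (fun p => ∑ h : Equiv.Perm (Option α), F (blockPartition
      (fun i => i.elim (p.1 : Equiv.Perm (Fin m)) fun j => (p.2 j : Equiv.Perm (Fin m))) h w)),
    Fintype.sum_prod_type]
  · have h1 : ∀ (b : Γ) (g : α → Γ), ∑ h : Equiv.Perm (Option α), F (blockPartition
        (fun i => i.elim (b : Equiv.Perm (Fin m)) fun j => (g j : Equiv.Perm (Fin m))) h w)
        = ∑ τ : Equiv.Perm α, F (merge (weightPartition (b : Equiv.Perm (Fin m)) fun _ => w none)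
            (blockPartition (fun i => (g i : Equiv.Perm (Fin m))) τ fun i => w (some i)))
          + ∑ x₀, ∑ τ : Equiv.Perm α, F (blockPartition
              (fun i => ((g * Pi.mulSingle x₀ b : α → Γ) i : Equiv.Perm (Fin m))) τ
              fun i => w (some i) + if i = x₀ then w none else 0) := by
      intro b g
      rw [Fintype.sum_equiv Equiv.Perm.decomposeOption _ (fun p => F (blockPartition
        (fun i => i.elim (b : Equiv.Perm (Fin m)) fun j => (g j : Equiv.Perm (Fin m)))
        (Equiv.Perm.decomposeOption.symm p) w)) (fun h => by rw [Equiv.symm_apply_apply]),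
        Fintype.sum_prod_type, Fintype.sum_option]
      congr 1
      · simp_rw [blockPartition_none]
      · refine Finset.sum_congr rfl fun x₀ _ => Finset.sum_congr rfl fun τ _ => ?_
        rw [blockPartition_some]
        congr 2
        funext i
        by_cases hi : i = x₀
        · subst hi; simp
        · simp [Pi.mulSingle_eq_of_ne hi]
    simp_rw [h1, Finset.sum_add_distrib]
    congr 1
    have h2 : ∀ b : Γ, ∑ g : α → Γ, ∑ x₀, ∑ τ : Equiv.Perm α, F (blockPartition
              (fun i => ((g * Pi.mulSingle x₀ b : α → Γ) i : Equiv.Perm (Fin m))) τ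
              fun i => w (some i) + if i = x₀ then w none else 0)
        = ∑ x₀, ∑ g : α → Γ, ∑ τ : Equiv.Perm α, F (blockPartition
              (fun i => (g i : Equiv.Perm (Fin m))) τ
              fun i => w (some i) + if i = x₀ then w none else 0) := by
      intro b
      rw [Finset.sum_comm]
      exact Finset.sum_congr rfl fun x₀ _ =>
        Fintype.sum_equiv (Equiv.mulRight (Pi.mulSingle x₀ b : α → Γ)) _
          (fun g => ∑ τ : Equiv.Perm α, F (blockPartition
              (fun i => (g i : Equiv.Perm (Fin m))) τ
              fun i => w (some i) + if i = x₀ then w none else 0))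
          fun g => by rw [Equiv.coe_mulRight]
    simp_rw [h2]
    rw [Finset.sum_const, Finset.card_univ, nsmul_eq_mul]
  · intro g
    refine Finset.sum_congr rfl fun h _ => ?_
    congr 2
    funext i
    cases i <;> rfl

/-- Iterated contraction of a distinguished block `x`, which already has `k` blocks merged
into it. -/
lemma blockSum_distinguished (v : ℝ) (n : ℕ) :
    ∀ (k : ℕ) (α : Type) [Fintype α], Fintype.card α = n → ∀ (x : α) (F : (ℕ → ℝ) → ℝ≥0∞),
      blockSum Γ α (fun i => v + if i = x then k * v else 0) F
        = ∑ j ∈ Finset.range n, ((Fintype.card Γ ^ j * (n - 1).descFactorial j : ℕ) : ℝ≥0∞) *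
          ∑ b : Γ, blockSum Γ (Fin (n - 1 - j)) (fun _ => v) fun a =>
            F (merge (weightPartition (b : Equiv.Perm (Fin m)) fun _ => ((k + 1 + j : ℕ) : ℝ) * v)
              a) := by
  induction n with
  | zero =>
    intro k α _ hα x
    exact absurd hα (Fintype.card_pos_iff.2 ⟨x⟩).ne'
  | succ n ih =>
    intro k α _ hα x F
    -- Identify `α` with `Option (Fin n)` in such a way that `x` becomes `none`.
    obtain ⟨e, he⟩ : ∃ e : Option (Fin n) ≃ α, e none = x := by
      have e₀ : Option (Fin n) ≃ α := Fintype.equivOfCardEq (by simp [hα])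
      exact ⟨e₀.trans (Equiv.swap (e₀ none) x), by simp⟩
    rw [← blockSum_congr Γ e]
    have hw : (fun i => v + if i = x then (k : ℝ) * v else 0) ∘ e
        = fun i : Option (Fin n) => v + if i = none then (k : ℝ) * v else 0 := by
      funext i
      simp only [Function.comp, ← he, e.apply_eq_iff_eq]
    rw [hw, blockSum_option, Finset.sum_range_succ']
    simp only [reduceCtorEq, if_false, add_zero, if_true]
    rw [add_comm]
    congr 1
    · rcases n.eq_zero_or_pos with rfl | hn
      · simp
      have hk : v + (k : ℝ) * v = ((k + 1 : ℕ) : ℝ) * v := by push_cast; ring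
      rw [hk]
      have h1 : ∀ x₀ : Fin n,
          blockSum Γ (Fin n) (fun i => v + if i = x₀ then ((k + 1 : ℕ) : ℝ) * v else 0) F
            = ∑ j ∈ Finset.range n,
              ((Fintype.card Γ ^ j * (n - 1).descFactorial j : ℕ) : ℝ≥0∞) *
              ∑ b : Γ, blockSum Γ (Fin (n - 1 - j)) (fun _ => v) fun a => F (merge
                (weightPartition (b : Equiv.Perm (Fin m)) fun _ => ((k + 1 + 1 + j : ℕ) : ℝ) * v)
                a) := fun x₀ => by
        convert ih (k + 1) (Fin n) (by simp) x₀ F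
      simp_rw [h1]
      rw [Finset.sum_const, Finset.card_univ, Fintype.card_fin, nsmul_eq_mul, Finset.mul_sum,
        Finset.mul_sum]
      refine Finset.sum_congr rfl fun j _ => ?_
      rw [← mul_assoc, ← mul_assoc]
      congr 1
      · obtain ⟨n, rfl⟩ := Nat.exists_eq_succ_of_ne_zero hn.ne'
        have : (n + 1 + 1 - 1).descFactorial (j + 1) = (n + 1) * n.descFactorial j :=
          Nat.succ_descFactorial_succ n j
        rw [this]
        simp only [Nat.succ_eq_add_one, Nat.add_sub_cancel]
        push_cast
        ring
      · refine Finset.sum_congr rfl fun b _ => ?_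
        rw [show n + 1 - 1 - (j + 1) = n - 1 - j by omega,
          show k + 1 + (j + 1) = k + 1 + 1 + j by omega]
    · simp only [pow_zero, Nat.descFactorial_zero, mul_one, Nat.cast_one, one_mul]
      refine Finset.sum_congr rfl fun b _ => ?_
      have : v + (k : ℝ) * v = ((k + 1 + 0 : ℕ) : ℝ) * v := by push_cast; ring
      rw [this]
      rfl

end Blocks

/-! ### Uniform laws, partitions of a given mass and the recursion for block permutations -/

section UniformLaw
variable {X Y : Type*}

/-- The law of `f x` for a uniformly random `x`, as a normalized sum of Dirac measures. -/
def uniformLaw [Finite X] (f : X → ℕ → ℝ) : Measure (ℕ → ℝ) :=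
  (Nat.card X : ℝ≥0∞)⁻¹ • Measure.sum fun x => Measure.dirac (f x)

lemma lintegral_uniformLaw [Fintype X] (f : X → ℕ → ℝ) (F : (ℕ → ℝ) → ℝ≥0∞) :
    ∫⁻ x, F x ∂uniformLaw f = (Fintype.card X : ℝ≥0∞)⁻¹ * ∑ x, F (f x) := by
  simp [uniformLaw, lintegral_smul_measure]

lemma uniformLaw_apply [Fintype X] (f : X → ℕ → ℝ) (s : Set (ℕ → ℝ)) :
    uniformLaw f s = (Fintype.card X : ℝ≥0∞)⁻¹ * ∑ x, s.indicator 1 (f x) := by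
  simp [uniformLaw]

lemma toMeasure_map_uniformOfFintype [Fintype X] [Nonempty X] (f : X → ℕ → ℝ) :
    ((PMF.uniformOfFintype X).map f).toMeasure = uniformLaw f := by
  let : MeasurableSpace X := ⊤
  ext s hs
  rw [PMF.toMeasure_map_apply f _ s (measurable_from_top) hs, PMF.toMeasure_apply_fintype,
    uniformLaw_apply, Finset.mul_sum]
  refine Finset.sum_congr rfl fun x _ => ?_
  by_cases hx : f x ∈ s <;> simp [hx]

instance [Finite X] [Nonempty X] (f : X → ℕ → ℝ) : IsProbabilityMeasure (uniformLaw f) := by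
  have := Fintype.ofFinite X
  constructor
  rw [uniformLaw_apply]
  simp only [Set.indicator_univ, Pi.one_apply, Finset.sum_const, Finset.card_univ, nsmul_eq_mul,
    mul_one]
  exact ENNReal.inv_mul_cancel (by simp) (by simp)

lemma ae_uniformLaw [Finite X] {f : X → ℕ → ℝ} {p : (ℕ → ℝ) → Prop} (h : ∀ x, p (f x)) :
    ∀ᵐ x ∂uniformLaw f, p x := by
  have := Fintype.ofFinite X
  rw [ae_iff, uniformLaw_apply]
  simp [h]

lemma map_uniformLaw [Finite X] (f : X → ℕ → ℝ) {φ : (ℕ → ℝ) → ℕ → ℝ} (hφ : Measurable φ) :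
    (uniformLaw f).map φ = uniformLaw fun x => φ (f x) := by
  have := Fintype.ofFinite X
  refine Measure.ext_of_lintegral _ fun F hF => ?_
  rw [lintegral_map hF hφ, lintegral_uniformLaw, lintegral_uniformLaw]

lemma uniformLaw_comp_equiv [Finite X] [Finite Y] (e : X ≃ Y) (f : Y → ℕ → ℝ) :
    uniformLaw (fun x => f (e x)) = uniformLaw f := by
  have := Fintype.ofFinite X
  have := Fintype.ofFinite Y
  refine Measure.ext_of_lintegral _ fun F hF => ?_
  rw [lintegral_uniformLaw, lintegral_uniformLaw, Fintype.card_congr e]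
  congr 1
  exact Fintype.sum_equiv e _ _ fun _ => rfl

end UniformLaw

section Partition

/-- Partitions of `s`: nonincreasing sequences of nonnegative reals with sum `s`. -/
structure IsPartition (s : ℝ≥0∞) (x : ℕ → ℝ) : Prop where
  nonneg : ∀ i, 0 ≤ x i
  antitone : Antitone x
  tsum_eq : ∑' i, ENNReal.ofReal (x i) = s

lemma mem_partitionsOfUnity_iff {x : ℕ → ℝ} : x ∈ partitionsOfUnity ↔ IsPartition 1 x := by
  constructor
  · rintro ⟨h0, hs, ha⟩
    refine ⟨h0, ha, ?_⟩
    rw [← ENNReal.ofReal_tsum_of_nonneg h0 hs.summable, hs.tsum_eq, ENNReal.ofReal_one]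
  · rintro ⟨h0, ha, hs⟩
    have hsum : Summable x := by
      have := ENNReal.summable_toReal (f := fun i => ENNReal.ofReal (x i)) (by simp [hs])
      simpa [ENNReal.toReal_ofReal (h0 _)] using this
    refine ⟨h0, ?_, ha⟩
    rw [hsum.hasSum_iff]
    rw [← ENNReal.ofReal_tsum_of_nonneg h0 hsum] at hs
    simpa using hs

lemma IsPartition.bddAbove {s : ℝ≥0∞} {x : ℕ → ℝ} (h : IsPartition s x) :
    BddAbove (Set.range x) :=
  bddAbove_range_of_antitone h.antitone

lemma isPartition_sortDesc {ι : Type*} [Countable ι] {x : ι → ℝ} {s : ℝ≥0∞}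
    (hx : BddAbove (Set.range x)) (h0 : ∀ i, 0 ≤ x i) (hs : ∑' i, ENNReal.ofReal (x i) = s) :
    IsPartition s (sortDesc x) :=
  ⟨sortDesc_nonneg x, antitone_sortDesc hx, by rw [tsum_ofReal_sortDesc hx h0, hs]⟩

lemma IsPartition.const_mul {s : ℝ≥0∞} {x : ℕ → ℝ} (h : IsPartition s x) {c : ℝ} (hc : 0 ≤ c) :
    IsPartition (ENNReal.ofReal c * s) fun i => c * x i where
  nonneg i := mul_nonneg hc (h.nonneg i)
  antitone _ _ hij := mul_le_mul_of_nonneg_left (h.antitone hij) hc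
  tsum_eq := by simp_rw [ENNReal.ofReal_mul hc]; rw [ENNReal.tsum_mul_left, h.tsum_eq]

lemma IsPartition.merge {s t : ℝ≥0∞} {x y : ℕ → ℝ} (hx : IsPartition s x) (hy : IsPartition t y) :
    IsPartition (s + t) (merge x y) := by
  refine isPartition_sortDesc (bddAbove_range_sumElim hx.bddAbove hy.bddAbove) ?_ ?_
  · rintro (i | i)
    exacts [hx.nonneg i, hy.nonneg i]
  · rw [ENNReal.summable.tsum_sum ENNReal.summable]
    simp [hx.tsum_eq, hy.tsum_eq]

lemma merge_zero_left {s : ℝ≥0∞} {x : ℕ → ℝ} (hx : IsPartition s x) :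
    merge (fun _ => 0) x = x := by
  rw [← sortDesc_eq_self hx.antitone hx.nonneg]
  refine sortDesc_congr fun t ht => ?_
  rw [encard_sumElim, sortDesc_eq_self hx.antitone hx.nonneg]
  simp [not_lt.2 ht]

lemma isPartition_weightPartition {X : Type*} [Fintype X] (σ : Equiv.Perm X) {w : X → ℝ}
    (hw : ∀ a, 0 ≤ w a) :
    IsPartition (ENNReal.ofReal (∑ a, w a)) (weightPartition σ w) := by
  classical
  have h0 : ∀ c, 0 ≤ cycleWeight σ w c := fun c =>
    Finset.sum_nonneg fun a _ => by split_ifs; exacts [hw a, le_rfl]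
  refine isPartition_sortDesc (bddAbove_cycleWeight σ w) h0 ?_
  let := Fintype.ofFinite (Cycles σ)
  rw [tsum_fintype, ← ENNReal.ofReal_sum_of_nonneg fun c _ => h0 c]
  congr 1
  simp only [cycleWeight]
  rw [Finset.sum_comm]
  refine Finset.sum_congr rfl fun a _ => ?_
  simp

lemma measurableSet_isPartition (s : ℝ≥0∞) : MeasurableSet {x | IsPartition s x} := by
  have : {x | IsPartition s x} = {x : ℕ → ℝ | (∀ i, 0 ≤ x i) ∧ (∀ i j, i ≤ j → x j ≤ x i) ∧
      ∑' i, ENNReal.ofReal (x i) = s} := by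
    ext x
    exact ⟨fun h => ⟨h.nonneg, h.antitone, h.tsum_eq⟩, fun h => ⟨h.1, h.2.1, h.2.2⟩⟩
  rw [this]
  refine .inter ?_ (.inter ?_ ?_)
  · exact measurableSet_setOfPred.2 (.forall fun i => measurableSet_setOfPred.1
      (measurableSet_le measurable_const (measurable_pi_apply i)))
  · exact measurableSet_setOfPred.2 (.forall fun i => .forall fun j => .imp measurable_const
      (measurableSet_setOfPred.1 (measurableSet_le (measurable_pi_apply j) (measurable_pi_apply i))))
  · exact measurableSet_eq_fun (.tsum fun i => (measurable_pi_apply i).ennreal_ofReal)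
      measurable_const

@[fun_prop]
lemma measurable_merge {Ω : Type*} [MeasurableSpace Ω] {f g : Ω → ℕ → ℝ} (hf : Measurable f)
    (hg : Measurable g) : Measurable fun ω => merge (f ω) (g ω) := by
  refine measurable_sortDesc ?_
  rintro (i | i)
  · exact (measurable_pi_apply i).comp hf
  · exact (measurable_pi_apply i).comp hg

end Partition

section BlockLaw
open Classical
variable {m : ℕ} (Γ : Subgroup (Equiv.Perm (Fin m)))

/-- The law of the cycle partition of a uniformly random element of `Γ ^ n ⋊ S_n`, normalized to
have total mass `n`. -/
def blockLaw (n : ℕ) : Measure (ℕ → ℝ) :=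
  uniformLaw fun p : (Fin n → Γ) × Equiv.Perm (Fin n) =>
    blockPartition (fun i => (p.1 i : Equiv.Perm (Fin m))) p.2 fun _ => 1 / (m : ℝ)

instance (n : ℕ) : IsProbabilityMeasure (blockLaw Γ n) := by unfold blockLaw; infer_instance

lemma cycleLaw_eq_uniformLaw_cyclePartition {α : Type*} [Fintype α]
    (G : Subgroup (Equiv.Perm α)) :
    cycleLaw G = uniformLaw fun σ : G => cyclePartition (σ : Equiv.Perm α) := by
  unfold cycleLaw
  rw [bind_pure_comp, PMF.monad_map_eq_map, PMF.map_comp, toMeasure_map_uniformOfFintype]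
  rfl

lemma cycleLaw_eq_uniformLaw :
    cycleLaw Γ = uniformLaw fun b : Γ =>
      weightPartition (b : Equiv.Perm (Fin m)) fun _ => 1 / (m : ℝ) := by
  rw [cycleLaw_eq_uniformLaw_cyclePartition]
  simp_rw [cyclePartition_eq, Nat.card_fin]

instance {α : Type*} [Fintype α] (G : Subgroup (Equiv.Perm α)) :
    IsProbabilityMeasure (cycleLaw G) := by
  rw [cycleLaw_eq_uniformLaw_cyclePartition]; infer_instance

lemma ae_cycleLaw_isPartition (hm : 1 ≤ m) : ∀ᵐ x ∂cycleLaw Γ, IsPartition 1 x := by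
  rw [cycleLaw_eq_uniformLaw]
  refine ae_uniformLaw fun b => ?_
  have := isPartition_weightPartition (b : Equiv.Perm (Fin m)) (w := fun _ => 1 / (m : ℝ))
    fun _ => by positivity
  have hm' : (m : ℝ) ≠ 0 := by positivity
  simpa [hm'] using this

lemma ae_blockLaw_isPartition (hm : 1 ≤ m) (n : ℕ) : ∀ᵐ x ∂blockLaw Γ n, IsPartition n x := by
  refine ae_uniformLaw fun p => ?_
  have := isPartition_weightPartition
    (blockPerm (fun i => (p.1 i : Equiv.Perm (Fin m))) p.2) (w := fun _ => 1 / (m : ℝ))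
    fun _ => by positivity
  have hm' : (m : ℝ) ≠ 0 := by positivity
  have h1 : ∑ _ : Fin n × Fin m, 1 / (m : ℝ) = n := by simp [hm']
  rw [h1, ENNReal.ofReal_natCast] at this
  exact this

lemma lintegral_blockLaw (n : ℕ) (F : (ℕ → ℝ) → ℝ≥0∞) :
    ∫⁻ x, F x ∂blockLaw Γ n
      = ((Fintype.card Γ ^ n * n.factorial : ℕ) : ℝ≥0∞)⁻¹
        * blockSum Γ (Fin n) (fun _ => 1 / (m : ℝ)) F := by
  unfold blockLaw
  rw [lintegral_uniformLaw, Fintype.sum_prod_type]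
  unfold blockSum
  rw [Fintype.card_prod, Fintype.card_perm, Fintype.card_fin, Fintype.card_fun, Fintype.card_fin]
  convert rfl

lemma measurable_const_mul_seq (c : ℝ) : Measurable fun (x : ℕ → ℝ) (i : ℕ) => c * x i :=
  by fun_prop

/-- The stick-breaking recursion for the cycles of block permutations. -/
lemma lintegral_blockLaw_recursion (n : ℕ) (F : (ℕ → ℝ) → ℝ≥0∞) :
    n * ∫⁻ x, F x ∂blockLaw Γ n
      = ∑ r ∈ Finset.range n, ∫⁻ b, ∫⁻ a, F (merge (fun i => ((n : ℝ) - r) * b i) a)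
          ∂blockLaw Γ r ∂cycleLaw Γ := by
  rcases n.eq_zero_or_pos with rfl | hn
  · simp
  have hc : (Fintype.card Γ : ℝ≥0∞) ≠ 0 := by simp
  have hct : (Fintype.card Γ : ℝ≥0∞) ≠ ⊤ := by simp
  have h1 := blockSum_distinguished Γ (1 / (m : ℝ)) n 0 (Fin n) (by simp) ⟨0, hn⟩ F
  simp only [CharP.cast_eq_zero, zero_mul, ite_self, add_zero, zero_add] at h1
  rw [lintegral_blockLaw, h1, ← Finset.sum_range_reflect, Finset.mul_sum, Finset.mul_sum]
  refine Finset.sum_congr rfl fun r hr => ?_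
  have hr' : r < n := Finset.mem_range.1 hr
  rw [show n - 1 - (n - 1 - r) = r by omega, cycleLaw_eq_uniformLaw, lintegral_uniformLaw]
  simp_rw [lintegral_blockLaw]
  rw [← Finset.mul_sum, ← mul_assoc, ← mul_assoc, ← mul_assoc]
  congr 1
  · rw [← ENNReal.mul_inv (.inl hc) (.inl hct)]
    refine ENNReal.eq_inv_of_mul_eq_one_left ?_
    have h2 : n * (Fintype.card Γ ^ (n - 1 - r) * (n - 1).descFactorial (n - 1 - r))
        * (Fintype.card Γ * (Fintype.card Γ ^ r * r.factorial))
        = Fintype.card Γ ^ n * n.factorial := by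
      have h3 := Nat.factorial_mul_descFactorial (show n - 1 - r ≤ n - 1 by omega)
      rw [show n - 1 - (n - 1 - r) = r by omega] at h3
      rw [← Nat.mul_factorial_pred hn.ne', ← h3]
      have h4 : Fintype.card Γ ^ n
          = Fintype.card Γ ^ (n - 1 - r) * Fintype.card Γ * Fintype.card Γ ^ r := by
        rw [← pow_succ, ← pow_add]; congr 1; omega
      rw [h4]; ring
    have h5 : ((Fintype.card Γ ^ n * n.factorial : ℕ) : ℝ≥0∞) ≠ 0 := by
      simp [Nat.factorial_ne_zero]
    refine Eq.trans ?_ (ENNReal.inv_mul_cancel h5 (ENNReal.natCast_ne_top _))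
    generalize (((Fintype.card Γ ^ n * n.factorial : ℕ) : ℝ≥0∞))⁻¹ = z
    rw [← h2]
    simp only [Nat.cast_mul, Nat.cast_pow]
    ring
  · refine Finset.sum_congr rfl fun b _ => ?_
    congr 1
    funext a
    rw [weightPartition_const_mul]
    · congr 3
      funext i
      congr 1
      rw [show 1 + (n - 1 - r) = n - r by omega, Nat.cast_sub hr'.le]
    · positivity

end BlockLaw

section Wreath
open Classical
variable {m : ℕ} (Γ : Subgroup (Equiv.Perm (Fin m)))

lemma wreathToPerm_apply (n : ℕ) (w : (Fin n → Γ) ⋊[mulAutArrow] Equiv.Perm (Fin n)) :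
    wreathToPerm Γ n w = blockPerm (fun i => (w.left i : Equiv.Perm (Fin m))) w.right := by
  ext p <;> rfl

lemma wreathToPerm_injective (hm : 1 ≤ m) (n : ℕ) : Function.Injective (wreathToPerm Γ n) := by
  intro v w h
  have h' : ∀ i a, (wreathToPerm Γ n v) (i, a) = (wreathToPerm Γ n w) (i, a) := fun i a => by rw [h]
  have hr : v.right = w.right := by
    ext i
    exact congrArg Fin.val (congrArg Prod.fst (h' i ⟨0, hm⟩))
  refine SemidirectProduct.ext ?_ hr
  funext i
  refine Subtype.ext (Equiv.ext fun a => ?_)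
  have := congrArg Prod.snd (h' (v.right⁻¹ i) a)
  simp only [wreathToPerm_apply, blockPerm_apply, ← hr] at this
  simpa using this

lemma cycleLaw_wreath (hm : 1 ≤ m) (n : ℕ) :
    cycleLaw (wreath Γ n) = (blockLaw Γ n).map fun x i => 1 / (n : ℝ) * x i := by
  unfold blockLaw
  rw [cycleLaw_eq_uniformLaw_cyclePartition, map_uniformLaw _ (measurable_const_mul_seq _)]
  let e : (Fin n → Γ) × Equiv.Perm (Fin n) ≃ wreath Γ n :=
    SemidirectProduct.equivProd.symm.trans
      (MonoidHom.ofInjective (wreathToPerm_injective Γ hm n)).toEquiv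
  rw [← uniformLaw_comp_equiv e]
  congr 1
  funext p
  have he : (e p : Equiv.Perm (Fin n × Fin m))
      = blockPerm (fun i => (p.1 i : Equiv.Perm (Fin m))) p.2 :=
    wreathToPerm_apply Γ n _
  rw [he, cyclePartition_eq, blockPartition, ← weightPartition_const_mul _ _ (by positivity)]
  congr 1
  funext _
  simp [mul_comm]

end Wreath

/-! ### Distances, and uniqueness of the stick law -/

section Distances

lemma distLinf_le_iff {x y : ℕ → ℝ} {M : ℝ≥0∞} :
    distLinf x y ≤ M ↔ ∀ i, ENNReal.ofReal |x i - y i| ≤ M := iSup_le_iff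

lemma distLinf_le_distL1 (x y : ℕ → ℝ) : distLinf x y ≤ distL1 x y :=
  distLinf_le_iff.2 fun i => ENNReal.le_tsum (f := fun i => ENNReal.ofReal |x i - y i|) i

lemma distL1_le_add {x y : ℕ → ℝ} {s t : ℝ≥0∞} (hx : IsPartition s x) (hy : IsPartition t y) :
    distL1 x y ≤ s + t := by
  rw [← hx.tsum_eq, ← hy.tsum_eq, ← ENNReal.tsum_add]
  refine ENNReal.tsum_le_tsum fun i => ?_
  rw [← ENNReal.ofReal_add (hx.nonneg i) (hy.nonneg i)]
  refine ENNReal.ofReal_le_ofReal ?_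
  have h1 := hx.nonneg i
  have h2 := hy.nonneg i
  rw [abs_le]; constructor <;> linarith

lemma distLinf_merge_le {x y x' y' : ℕ → ℝ} (hx : BddAbove (Set.range x))
    (hy : BddAbove (Set.range y)) (hx' : BddAbove (Set.range x'))
    (hy' : BddAbove (Set.range y')) :
    distLinf (merge x y) (merge x' y') ≤ max (distLinf x x') (distLinf y y') := by
  rcases eq_or_ne (max (distLinf x x') (distLinf y y')) ⊤ with h | h
  · rw [h]; exact le_top
  rw [distLinf_le_iff]
  intro k
  rw [← ENNReal.ofReal_toReal h]
  refine ENNReal.ofReal_le_ofReal (sortDesc_lipschitz (bddAbove_range_sumElim hx hy)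
    (bddAbove_range_sumElim hx' hy') ?_ k ENNReal.toReal_nonneg)
  rintro (i | i)
  · rw [← ENNReal.ofReal_le_iff_le_toReal h]
    exact (distLinf_le_iff.1 le_rfl i).trans (le_max_left _ _)
  · rw [← ENNReal.ofReal_le_iff_le_toReal h]
    exact (distLinf_le_iff.1 le_rfl i).trans (le_max_right _ _)

lemma distL1_merge_le {x y x' y' : ℕ → ℝ} {a b c d : ℝ≥0∞} (hx : IsPartition a x)
    (hy : IsPartition b y) (hx' : IsPartition c x') (hy' : IsPartition d y') :
    distL1 (merge x y) (merge x' y') ≤ distL1 x x' + distL1 y y' := by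
  refine (tsum_abs_sortDesc_sub_le (bddAbove_range_sumElim hx.bddAbove hy.bddAbove)
    (bddAbove_range_sumElim hx'.bddAbove hy'.bddAbove) ?_ ?_).trans ?_
  · rintro (i | i)
    exacts [hx.nonneg i, hy.nonneg i]
  · rintro (i | i)
    exacts [hx'.nonneg i, hy'.nonneg i]
  · rw [ENNReal.summable.tsum_sum ENNReal.summable]
    rfl

lemma distL1_const_mul_const_mul {b : ℕ → ℝ} (hb : IsPartition 1 b) (c d : ℝ) :
    distL1 (fun i => c * b i) (fun i => d * b i) = ENNReal.ofReal |c - d| := by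
  unfold distL1
  simp_rw [← sub_mul, abs_mul, ENNReal.ofReal_mul (abs_nonneg _), abs_of_nonneg (hb.nonneg _)]
  rw [ENNReal.tsum_mul_left, hb.tsum_eq, mul_one]

lemma distLinf_const_mul {c : ℝ} (hc : 0 ≤ c) (x y : ℕ → ℝ) :
    distLinf (fun i => c * x i) (fun i => c * y i) = ENNReal.ofReal c * distLinf x y := by
  unfold distLinf
  simp_rw [← mul_sub, abs_mul, abs_of_nonneg hc, ENNReal.ofReal_mul hc]
  rw [ENNReal.mul_iSup]

lemma distL1_const_mul {c : ℝ} (hc : 0 ≤ c) (x y : ℕ → ℝ) :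
    distL1 (fun i => c * x i) (fun i => c * y i) = ENNReal.ofReal c * distL1 x y := by
  unfold distL1
  simp_rw [← mul_sub, abs_mul, abs_of_nonneg hc, ENNReal.ofReal_mul hc]
  rw [ENNReal.tsum_mul_left]

@[fun_prop]
lemma measurable_distLinf : Measurable fun p : (ℕ → ℝ) × (ℕ → ℝ) => distLinf p.1 p.2 := by
  unfold distLinf
  refine .iSup fun i => ENNReal.measurable_ofReal.comp ?_
  exact (continuous_abs.measurable).comp (by fun_prop)

@[fun_prop]
lemma measurable_distL1 : Measurable fun p : (ℕ → ℝ) × (ℕ → ℝ) => distL1 p.1 p.2 := by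
  unfold distL1
  refine .tsum fun i => ENNReal.measurable_ofReal.comp ?_
  exact (continuous_abs.measurable).comp (by fun_prop)

end Distances

section Uniform

instance isProbabilityMeasure_restrict_Icc :
    IsProbabilityMeasure (volume.restrict (Set.Icc (0 : ℝ) 1)) :=
  ⟨by simp⟩

lemma lintegral_Icc_ofReal {f : ℝ → ℝ} (hf : ContinuousOn f (Set.Icc 0 1))
    (h0 : ∀ u ∈ Set.Icc (0 : ℝ) 1, 0 ≤ f u) :
    ∫⁻ u in Set.Icc (0 : ℝ) 1, ENNReal.ofReal (f u) = ENNReal.ofReal (∫ u in (0 : ℝ)..1, f u) := by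
  rw [intervalIntegral.integral_of_le zero_le_one, ← integral_Icc_eq_integral_Ioc,
    ofReal_integral_eq_lintegral_ofReal hf.integrableOn_Icc]
  exact (ae_restrict_iff' measurableSet_Icc).2 (.of_forall h0)

lemma lintegral_Icc_id : ∫⁻ u in Set.Icc (0 : ℝ) 1, ENNReal.ofReal u = 2⁻¹ := by
  rw [lintegral_Icc_ofReal (f := fun u => u) continuousOn_id fun u hu => hu.1]
  simp only [integral_id]
  rw [← ENNReal.ofReal_ofNat, ← ENNReal.ofReal_inv_of_pos (by norm_num)]
  norm_num

lemma lintegral_Icc_one_sub : ∫⁻ u in Set.Icc (0 : ℝ) 1, ENNReal.ofReal (1 - u) = 2⁻¹ := by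
  rw [lintegral_Icc_ofReal (f := fun u => 1 - u) (by fun_prop) fun u hu => by linarith [hu.2]]
  rw [← ENNReal.ofReal_ofNat, ← ENNReal.ofReal_inv_of_pos (by norm_num)]
  congr 1
  rw [intervalIntegral.integral_sub (by simp) (by simp)]
  simp
  norm_num

end Uniform

section StickLaw

@[fun_prop]
lemma measurable_stickMerge {Ω : Type*} [MeasurableSpace Ω] {u : Ω → ℝ} {b a : Ω → ℕ → ℝ}
    (hu : Measurable u) (hb : Measurable b) (ha : Measurable a) :
    Measurable fun ω => stickMerge (u ω) (b ω) (a ω) := by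
  simp_rw [stickMerge_eq_merge]
  exact measurable_merge (by fun_prop) (by fun_prop)

variable {B A A' : Measure (ℕ → ℝ)}

lemma IsStickLaw.ae_isPartition (hA : IsStickLaw B A) : ∀ᵐ a ∂A, IsPartition 1 a :=
  hA.mem_partitionsOfUnity.mono fun _ h => mem_partitionsOfUnity_iff.1 h

lemma ae_mem_Icc : ∀ᵐ u ∂volume.restrict (Set.Icc (0 : ℝ) 1), u ∈ Set.Icc (0 : ℝ) 1 :=
  ae_restrict_mem measurableSet_Icc

lemma ae_fst {α β : Type*} [MeasurableSpace α] [MeasurableSpace β] {μ : Measure (α × β)}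
    {p : α → Prop} (h : ∀ᵐ x ∂μ.fst, p x) : ∀ᵐ z ∂μ, p z.1 :=
  (Measure.tendsto_ae_map measurable_fst.aemeasurable).eventually h

lemma ae_snd {α β : Type*} [MeasurableSpace α] [MeasurableSpace β] {μ : Measure (α × β)}
    {p : β → Prop} (h : ∀ᵐ x ∂μ.snd, p x) : ∀ᵐ z ∂μ, p z.2 :=
  (Measure.tendsto_ae_map measurable_snd.aemeasurable).eventually h

lemma IsStickLaw.lintegral_eq (hA : IsStickLaw B A) [SFinite B] {F : (ℕ → ℝ) → ℝ≥0∞}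
    (hF : Measurable F) :
    ∫⁻ a, F a ∂A = ∫⁻ u in Set.Icc (0 : ℝ) 1, ∫⁻ b, ∫⁻ a, F (stickMerge u b a) ∂A ∂B := by
  have := hA.isProbabilityMeasure
  conv_lhs => rw [hA.selfSimilar]
  rw [lintegral_map hF (by fun_prop), lintegral_prod]
  · refine lintegral_congr fun u => ?_
    rw [lintegral_prod]
    exact Measurable.aemeasurable (by fun_prop)
  · exact Measurable.aemeasurable (by fun_prop)

/-- Two laws that have couplings with arbitrarily small expected uniform distance are equal. -/
lemma eq_of_forall_coupling [IsProbabilityMeasure A] [IsProbabilityMeasure A']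
    (h : ∀ ε : ℝ≥0∞, 0 < ε → ∃ π : Measure ((ℕ → ℝ) × (ℕ → ℝ)),
      π.fst = A ∧ π.snd = A' ∧ ∫⁻ p, distLinf p.1 p.2 ∂π ≤ ε) : A = A' := by
  have hI : ∀ I : Finset ℕ, A.map I.restrict = A'.map I.restrict := by
    intro I
    have hmI : Measurable (I.restrict : (ℕ → ℝ) → (I → ℝ)) := Finset.measurable_restrict I
    have := Measure.isProbabilityMeasure_map (μ := A) hmI.aemeasurable
    have := Measure.isProbabilityMeasure_map (μ := A') hmI.aemeasurable
    -- It suffices to compare the integrals of bounded Lipschitz functions.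
    suffices hf : ∀ f : (I → ℝ) → ℝ, (∃ C : ℝ, ∀ x y, dist (f x) (f y) ≤ C) →
        (∃ L, LipschitzWith L f) → ∫ x, f x ∂(A'.map I.restrict) = ∫ x, f x ∂(A.map I.restrict) by
      let μ : ProbabilityMeasure (I → ℝ) := ⟨A.map I.restrict, inferInstance⟩
      let μ' : ProbabilityMeasure (I → ℝ) := ⟨A'.map I.restrict, inferInstance⟩
      have ht : Filter.Tendsto (fun _ : ℕ => μ') Filter.atTop (nhds μ) := by
        rw [tendsto_iff_forall_lipschitz_integral_tendsto]
        intro f hb hL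
        exact (hf f hb hL) ▸ tendsto_const_nhds
      have := tendsto_nhds_unique ht tendsto_const_nhds
      exact congrArg Subtype.val this
    rintro f ⟨C, hC⟩ ⟨L, hL⟩
    have hfm : Measurable f := hL.continuous.measurable
    have hbd : ∀ x, ‖f x‖ ≤ C + ‖f 0‖ := fun x => by
      have := hC x 0
      rw [dist_eq_norm] at this
      linarith [norm_sub_norm_le (f x) (f 0)]
    have hle : ∀ ε : ℝ≥0∞, 0 < ε →
        ‖∫ x, f x ∂(A'.map I.restrict) - ∫ x, f x ∂(A.map I.restrict)‖ₑ ≤ L * ε := by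
      intro ε hε
      obtain ⟨π, h1, h2, h3⟩ := h ε hε
      have hπ : IsProbabilityMeasure π := by
        constructor
        rw [← Measure.fst_univ, h1]; exact measure_univ
      have i1 : Integrable (fun p : (ℕ → ℝ) × (ℕ → ℝ) => f (I.restrict p.1)) π :=
        Integrable.of_bound (Measurable.aestronglyMeasurable (by fun_prop)) _ (.of_forall fun p => hbd _)
      have i2 : Integrable (fun p : (ℕ → ℝ) × (ℕ → ℝ) => f (I.restrict p.2)) π :=
        Integrable.of_bound (Measurable.aestronglyMeasurable (by fun_prop)) _ (.of_forall fun p => hbd _)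
      have e1 : ∫ x, f x ∂(A.map I.restrict) = ∫ p, f (I.restrict p.1) ∂π := by
        rw [← h1, Measure.fst, Measure.map_map hmI measurable_fst,
          integral_map (by fun_prop) (by fun_prop)]
        rfl
      have e2 : ∫ x, f x ∂(A'.map I.restrict) = ∫ p, f (I.restrict p.2) ∂π := by
        rw [← h2, Measure.snd, Measure.map_map hmI measurable_snd,
          integral_map (by fun_prop) (by fun_prop)]
        rfl
      rw [e1, e2, ← integral_sub i2 i1]
      refine (enorm_integral_le_lintegral_enorm _).trans ?_
      refine le_trans ?_ (mul_le_mul_right h3 (L : ℝ≥0∞))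
      rw [← lintegral_const_mul _ measurable_distLinf]
      refine lintegral_mono fun p => ?_
      rw [← edist_eq_enorm_sub, edist_comm]
      refine (hL _ _).trans (mul_le_mul_right ?_ _)
      refine edist_pi_le_iff.2 fun i => ?_
      rw [edist_dist, Real.dist_eq]
      exact distLinf_le_iff.1 le_rfl _
    have h0 : ‖∫ x, f x ∂(A'.map I.restrict) - ∫ x, f x ∂(A.map I.restrict)‖ₑ = 0 := by
      refine le_antisymm (ENNReal.le_of_forall_pos_le_add fun δ hδ _ => ?_) bot_le
      refine (hle (δ / (L + 1)) (ENNReal.div_pos (by simpa using hδ.ne') (by finiteness))).trans ?_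
      rw [zero_add, ← mul_div_assoc, mul_comm, ]
      refine ENNReal.div_le_of_le_mul ?_
      exact mul_le_mul_right le_self_add _
    exact sub_eq_zero.1 (enorm_eq_zero.1 h0)
  have hA : IsProjectiveLimit A fun I => A.map I.restrict := fun I => rfl
  have hA' : IsProjectiveLimit A' fun I => A.map I.restrict := fun I => (hI I).symm
  exact hA.unique hA'

/-- Feeding both laws of a coupling with the same stick halves the expected distance. -/
lemma IsStickLaw.exists_coupling [IsProbabilityMeasure B] (hB : ∀ᵐ b ∂B, IsPartition 1 b)
    (hA : IsStickLaw B A) (hA' : IsStickLaw B A') (k : ℕ) :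
    ∃ π : Measure ((ℕ → ℝ) × (ℕ → ℝ)), π.fst = A ∧ π.snd = A' ∧
      ∫⁻ p, distLinf p.1 p.2 ∂π ≤ 2⁻¹ ^ k * 2 := by
  have := hA.isProbabilityMeasure
  have := hA'.isProbabilityMeasure
  induction k with
  | zero =>
    refine ⟨A.prod A', by simp, by simp, ?_⟩
    have : ∀ᵐ p ∂A.prod A', distLinf p.1 p.2 ≤ 2 := by
      filter_upwards [ae_fst (μ := A.prod A') (by simpa using hA.ae_isPartition),
        ae_snd (μ := A.prod A') (by simpa using hA'.ae_isPartition)] with p h1 h2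
      exact (distLinf_le_distL1 _ _).trans ((distL1_le_add h1 h2).trans one_add_one_eq_two.le)
    refine (lintegral_mono_ae this).trans ?_
    simp
  | succ k ih =>
    obtain ⟨π, h1, h2, h3⟩ := ih
    have hπ : IsProbabilityMeasure π := by
      constructor
      rw [← Measure.fst_univ, h1]; exact measure_univ
    have hm1 : Measurable fun p : ℝ × (ℕ → ℝ) × ((ℕ → ℝ) × (ℕ → ℝ)) =>
        stickMerge p.1 p.2.1 p.2.2.1 := by fun_prop
    have hm2 : Measurable fun p : ℝ × (ℕ → ℝ) × ((ℕ → ℝ) × (ℕ → ℝ)) =>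
        stickMerge p.1 p.2.1 p.2.2.2 := by fun_prop
    refine ⟨((volume.restrict (Set.Icc (0 : ℝ) 1)).prod (B.prod π)).map fun p =>
      (stickMerge p.1 p.2.1 p.2.2.1, stickMerge p.1 p.2.1 p.2.2.2), ?_, ?_, ?_⟩
    · rw [Measure.fst_map_prodMk hm2]
      refine Measure.ext_of_lintegral _ fun F hF => ?_
      rw [hA.lintegral_eq hF, lintegral_map hF hm1, lintegral_prod _ (Measurable.aemeasurable (by fun_prop))]
      refine lintegral_congr fun u => ?_
      rw [lintegral_prod _ (Measurable.aemeasurable (by fun_prop))]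
      refine lintegral_congr fun b => ?_
      rw [← h1, Measure.fst, lintegral_map _ measurable_fst]
      fun_prop
    · rw [Measure.snd_map_prodMk hm1]
      refine Measure.ext_of_lintegral _ fun F hF => ?_
      rw [hA'.lintegral_eq hF, lintegral_map hF hm2, lintegral_prod _ (Measurable.aemeasurable (by fun_prop))]
      refine lintegral_congr fun u => ?_
      rw [lintegral_prod _ (Measurable.aemeasurable (by fun_prop))]
      refine lintegral_congr fun b => ?_
      rw [← h2, Measure.snd, lintegral_map _ measurable_snd]
      fun_prop
    · rw [lintegral_map measurable_distLinf (hm1.prodMk hm2)]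
      have hae : ∀ᵐ p ∂(volume.restrict (Set.Icc (0 : ℝ) 1)).prod (B.prod π),
          distLinf (stickMerge p.1 p.2.1 p.2.2.1) (stickMerge p.1 p.2.1 p.2.2.2)
            ≤ ENNReal.ofReal (1 - p.1) * distLinf p.2.2.1 p.2.2.2 := by
        have ha1 := ae_fst (h1 ▸ hA.ae_isPartition)
        have ha2 := ae_snd (h2 ▸ hA'.ae_isPartition)
        have ha := ha1.and ha2
        have e1 := ae_fst (μ := (volume.restrict (Set.Icc (0 : ℝ) 1)).prod (B.prod π))
          (by rw [Measure.fst_prod]; exact ae_mem_Icc)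
        have e2 := ae_snd (μ := (volume.restrict (Set.Icc (0 : ℝ) 1)).prod (B.prod π))
          (by rw [Measure.snd_prod]; exact ae_fst (by rw [Measure.fst_prod]; exact hB))
        have e3 := ae_snd (μ := (volume.restrict (Set.Icc (0 : ℝ) 1)).prod (B.prod π))
          (by rw [Measure.snd_prod]; exact ae_snd (by rw [Measure.snd_prod]; exact ha))
        filter_upwards [e1, e2, e3] with p hu hb ha
        have h0 := sub_nonneg.2 hu.2
        refine (distLinf_merge_le (hb.const_mul hu.1).bddAbove (ha.1.const_mul h0).bddAbove
          (hb.const_mul hu.1).bddAbove (ha.2.const_mul h0).bddAbove).trans ?_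
        rw [distLinf_const_mul h0]
        simp [distLinf]
      refine (lintegral_mono_ae hae).trans ?_
      rw [lintegral_prod_mul (f := fun u => ENNReal.ofReal (1 - u))
        (g := fun p : (ℕ → ℝ) × ((ℕ → ℝ) × (ℕ → ℝ)) => distLinf p.2.1 p.2.2) (by fun_prop)
        (measurable_distLinf.comp measurable_snd).aemeasurable, lintegral_Icc_one_sub]
      rw [lintegral_prod (fun p : (ℕ → ℝ) × ((ℕ → ℝ) × (ℕ → ℝ)) => distLinf p.2.1 p.2.2)
        (measurable_distLinf.comp measurable_snd).aemeasurable]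
      simp only [lintegral_const, measure_univ, mul_one]
      rw [pow_succ', mul_assoc]
      gcongr

theorem IsStickLaw.unique [IsProbabilityMeasure B] (hB : ∀ᵐ b ∂B, IsPartition 1 b)
    (hA : IsStickLaw B A) (hA' : IsStickLaw B A') : A = A' := by
  have := hA.isProbabilityMeasure
  have := hA'.isProbabilityMeasure
  refine eq_of_forall_coupling fun ε hε => ?_
  have ht : Filter.Tendsto (fun k : ℕ => (2⁻¹ : ℝ≥0∞) ^ k * 2) Filter.atTop (nhds (0 * 2)) :=
    ENNReal.Tendsto.mul_const (ENNReal.tendsto_pow_atTop_nhds_zero_of_lt_one (by simp))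
      (.inr (by simp))
  rw [zero_mul] at ht
  obtain ⟨k, hk⟩ := (ht.eventually (gt_mem_nhds hε)).exists
  obtain ⟨π, h1, h2, h3⟩ := hA.exists_coupling hB hA' k
  exact ⟨π, h1, h2, h3.trans hk.le⟩

end StickLaw

/-! ### Existence of the stick law -/

section ConsMeasure
variable {X : Type*} [MeasurableSpace X]

/-- The sequence with first term `p.1` followed by the sequence `p.2`. -/
def consSeq (p : X × (ℕ → X)) (n : ℕ) : X := Nat.casesOn n p.1 p.2

@[simp]
lemma consSeq_zero {X : Type*} (p : X × (ℕ → X)) : consSeq p 0 = p.1 := rfl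

@[simp]
lemma consSeq_succ {X : Type*} (p : X × (ℕ → X)) (n : ℕ) : consSeq p (n + 1) = p.2 n := rfl

lemma measurable_consSeq : Measurable (consSeq : X × (ℕ → X) → ℕ → X) := by
  refine measurable_pi_lambda _ fun n => ?_
  cases n with
  | zero => exact measurable_fst
  | succ n => exact (measurable_pi_apply n).comp measurable_snd

lemma map_consSeq_infinitePi (ν : Measure X) [IsProbabilityMeasure ν] :
    (ν.prod (Measure.infinitePi fun _ : ℕ => ν)).map consSeq = Measure.infinitePi fun _ => ν := by
  refine Measure.eq_infinitePi _ fun s t ht => ?_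
  rw [Measure.map_apply measurable_consSeq (.pi s.countable_toSet fun i _ => ht i)]
  classical
  let s' : Finset ℕ := s.preimage Nat.succ (Nat.succ_injective.injOn)
  let t₀ : Set X := if 0 ∈ s then t 0 else Set.univ
  have hset : (consSeq : X × (ℕ → X) → ℕ → X) ⁻¹' (Set.pi s t)
      = t₀ ×ˢ Set.pi s' fun i => t (i + 1) := by
    ext ⟨x, ω⟩
    simp only [Set.mem_preimage, Set.mem_pi, Set.mem_prod, Finset.mem_coe, s', Finset.mem_preimage]
    constructor
    · intro h
      refine ⟨?_, fun i hi => h (i + 1) hi⟩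
      by_cases h0 : 0 ∈ s
      · simpa [t₀, h0] using h 0 h0
      · simp [t₀, h0]
    · rintro ⟨h1, h2⟩ (_ | i) hi
      · simpa [t₀, hi] using h1
      · exact h2 i hi
  rw [hset, Measure.prod_prod, Measure.infinitePi_pi _ fun i _ => ht (i + 1)]
  have hs : s = (if 0 ∈ s then {0} else ∅) ∪ s'.map ⟨Nat.succ, Nat.succ_injective⟩ := by
    ext (_ | i)
    · by_cases h0 : 0 ∈ s <;> simp [h0]
    · by_cases h0 : 0 ∈ s <;> simp [h0, s']
  conv_rhs => rw [hs]
  rw [Finset.prod_union, Finset.prod_map]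
  · congr 1
    by_cases h0 : 0 ∈ s <;> simp [t₀, h0]
  · by_cases h0 : 0 ∈ s <;> simp [h0]

end ConsMeasure

section Existence

/-- The fraction of the unit stick that is left after `j` breaks at the relative positions
`(ω i).1`. -/
def stickRest (ω : ℕ → ℝ × (ℕ → ℝ)) (j : ℕ) : ℝ := ∏ i ∈ Finset.range j, (1 - (ω i).1)

/-- The pieces of the unit stick: the `j`-th part that is broken off is divided in the
proportions `(ω j).2`. -/
def stickPieces (ω : ℕ → ℝ × (ℕ → ℝ)) (p : ℕ × ℕ) : ℝ :=
  stickRest ω p.1 * ((ω p.1).1 * (ω p.1).2 p.2)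

/-- The breaks lie in `[0, 1]` and the proportions are partitions of unity. -/
def IsBreaking (ω : ℕ → ℝ × (ℕ → ℝ)) : Prop :=
  ∀ j, (ω j).1 ∈ Set.Icc (0 : ℝ) 1 ∧ IsPartition 1 (ω j).2

lemma stickPieces_consSeq_zero (x : ℝ × (ℕ → ℝ)) (ω : ℕ → ℝ × (ℕ → ℝ)) (i : ℕ) :
    stickPieces (consSeq (x, ω)) (0, i) = x.1 * x.2 i := by
  simp [stickPieces, stickRest]

lemma stickPieces_consSeq_succ (x : ℝ × (ℕ → ℝ)) (ω : ℕ → ℝ × (ℕ → ℝ)) (j i : ℕ) :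
    stickPieces (consSeq (x, ω)) (j + 1, i) = (1 - x.1) * stickPieces ω (j, i) := by
  simp only [stickPieces, stickRest, Finset.prod_range_succ']
  simp only [consSeq_zero, consSeq_succ]
  ring

lemma IsBreaking.stickRest_nonneg {ω : ℕ → ℝ × (ℕ → ℝ)} (h : IsBreaking ω) (j : ℕ) :
    0 ≤ stickRest ω j :=
  Finset.prod_nonneg fun i _ => sub_nonneg.2 (h i).1.2

lemma IsBreaking.stickPieces_nonneg {ω : ℕ → ℝ × (ℕ → ℝ)} (h : IsBreaking ω) (p : ℕ × ℕ) :
    0 ≤ stickPieces ω p :=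
  mul_nonneg (h.stickRest_nonneg _) (mul_nonneg (h _).1.1 ((h _).2.nonneg _))

lemma IsBreaking.tsum_stickPieces_le {ω : ℕ → ℝ × (ℕ → ℝ)} (h : IsBreaking ω) :
    ∑' p, ENNReal.ofReal (stickPieces ω p) ≤ 1 := by
  rw [ENNReal.tsum_prod']
  have h1 : ∀ j, ∑' i, ENNReal.ofReal (stickPieces ω (j, i))
      = ENNReal.ofReal (stickRest ω j - stickRest ω (j + 1)) := by
    intro j
    simp only [stickPieces, ← mul_assoc]
    have h0 := mul_nonneg (h.stickRest_nonneg j) (h j).1.1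
    simp_rw [ENNReal.ofReal_mul h0]
    rw [ENNReal.tsum_mul_left, (h j).2.tsum_eq, mul_one]
    congr 1
    simp only [stickRest, Finset.prod_range_succ]
    ring
  simp_rw [h1]
  refine ENNReal.tsum_le_of_sum_range_le fun n => ?_
  rw [← ENNReal.ofReal_sum_of_nonneg, Finset.sum_range_sub', ENNReal.ofReal_le_one]
  · have := h.stickRest_nonneg n
    simp only [stickRest, Finset.range_zero, Finset.prod_empty] at this ⊢
    linarith
  · intro j _
    simp only [stickRest, Finset.prod_range_succ]
    have := mul_nonneg (h.stickRest_nonneg j) (h j).1.1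
    simp only [stickRest] at this
    linarith

lemma IsBreaking.bddAbove_stickPieces {ω : ℕ → ℝ × (ℕ → ℝ)} (h : IsBreaking ω) :
    BddAbove (Set.range (stickPieces ω)) := by
  refine ⟨1, ?_⟩
  rintro _ ⟨p, rfl⟩
  rw [← ENNReal.ofReal_le_one]
  exact (ENNReal.le_tsum p).trans h.tsum_stickPieces_le

lemma tsum_stickPieces_consSeq {x : ℝ × (ℕ → ℝ)} {ω : ℕ → ℝ × (ℕ → ℝ)}
    (hx : x.1 ∈ Set.Icc (0 : ℝ) 1 ∧ IsPartition 1 x.2) :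
    ∑' p, ENNReal.ofReal (stickPieces (consSeq (x, ω)) p)
      = ENNReal.ofReal x.1
        + ENNReal.ofReal (1 - x.1) * ∑' p, ENNReal.ofReal (stickPieces ω p) := by
  rw [ENNReal.tsum_prod', tsum_eq_zero_add' ENNReal.summable]
  simp_rw [stickPieces_consSeq_zero, stickPieces_consSeq_succ, ENNReal.ofReal_mul hx.1.1,
    ENNReal.ofReal_mul (sub_nonneg.2 hx.1.2), ENNReal.tsum_mul_left, hx.2.tsum_eq]
  rw [mul_one, ENNReal.tsum_prod']

lemma sortDesc_stickPieces_consSeq {x : ℝ × (ℕ → ℝ)} {ω : ℕ → ℝ × (ℕ → ℝ)}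
    (hx : x.1 ∈ Set.Icc (0 : ℝ) 1) (hω : IsBreaking ω) :
    sortDesc (stickPieces (consSeq (x, ω))) = stickMerge x.1 x.2 (sortDesc (stickPieces ω)) := by
  let e : ℕ ⊕ (ℕ × ℕ) ≃ ℕ × ℕ :=
    { toFun := Sum.elim (fun i => (0, i)) (fun p => (p.1 + 1, p.2))
      invFun := fun p => Nat.casesOn p.1 (.inl p.2) (fun j => .inr (j, p.2))
      left_inv := by rintro (a | ⟨i, a⟩) <;> rfl
      right_inv := by rintro ⟨_ | i, a⟩ <;> rfl }
  rw [← sortDesc_comp_equiv e]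
  have he : stickPieces (consSeq (x, ω)) ∘ e
      = Sum.elim (fun i => x.1 * x.2 i) fun p => (1 - x.1) * stickPieces ω p := by
    funext i
    rcases i with i | ⟨j, i⟩
    · exact stickPieces_consSeq_zero x ω i
    · exact stickPieces_consSeq_succ x ω j i
  rw [he]
  refine sortDesc_congr fun t ht => ?_
  rw [encard_sumElim, encard_sumElim,
    encard_const_mul_sortDesc hω.bddAbove_stickPieces (sub_nonneg.2 hx.2) ht]

lemma measurable_stickPieces (p : ℕ × ℕ) : Measurable fun ω => stickPieces ω p := by
  unfold stickPieces stickRest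
  fun_prop

theorem exists_isStickLaw {B : Measure (ℕ → ℝ)} [IsProbabilityMeasure B]
    (hB : ∀ᵐ b ∂B, IsPartition 1 b) : ∃ A, IsStickLaw B A := by
  set ν : Measure (ℝ × (ℕ → ℝ)) := (volume.restrict (Set.Icc (0 : ℝ) 1)).prod B with hν
  set P : Measure (ℕ → ℝ × (ℕ → ℝ)) := Measure.infinitePi fun _ => ν with hP
  have hP1 : IsProbabilityMeasure P := by rw [hP]; infer_instance
  have hPc : (ν.prod P).map consSeq = P := map_consSeq_infinitePi ν
  have hνae : ∀ᵐ x ∂ν, x.1 ∈ Set.Icc (0 : ℝ) 1 ∧ IsPartition 1 x.2 :=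
    (ae_fst (by rw [hν, Measure.fst_prod]; exact ae_mem_Icc)).and
      (ae_snd (by rw [hν, Measure.snd_prod]; exact hB))
  have hPae : ∀ᵐ ω ∂P, IsBreaking ω :=
    ae_all_iff.2 fun j =>
      (measurePreserving_eval_infinitePi (fun _ => ν) j).quasiMeasurePreserving.ae hνae
  have hae : ∀ᵐ z ∂ν.prod P, (z.1.1 ∈ Set.Icc (0 : ℝ) 1 ∧ IsPartition 1 z.1.2) ∧ IsBreaking z.2 :=
    (ae_fst (μ := ν.prod P) (by rw [Measure.fst_prod]; exact hνae)).and
      (ae_snd (μ := ν.prod P) (by rw [Measure.snd_prod]; exact hPae))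
  have hΦ : Measurable fun ω => sortDesc (stickPieces ω) :=
    measurable_sortDesc measurable_stickPieces
  have hT : Measurable fun ω => ∑' p, ENNReal.ofReal (stickPieces ω p) :=
    .tsum fun p => (measurable_stickPieces p).ennreal_ofReal
  refine ⟨P.map fun ω => sortDesc (stickPieces ω), Measure.isProbabilityMeasure_map hΦ.aemeasurable,
    ?_, ?_⟩
  · -- The expected total mass `M` satisfies `M = 1 / 2 + M / 2`, so no mass is lost.
    set M := ∫⁻ ω, ∑' p, ENNReal.ofReal (stickPieces ω p) ∂P with hM
    have hle : ∀ᵐ ω ∂P, ∑' p, ENNReal.ofReal (stickPieces ω p) ≤ 1 :=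
      hPae.mono fun ω hω => hω.tsum_stickPieces_le
    have hM1 : M ≤ 1 := (lintegral_mono_ae hle).trans (by simp)
    have hMeq : M = 2⁻¹ + 2⁻¹ * M := by
      conv_lhs => rw [hM, ← hPc]
      rw [lintegral_map hT measurable_consSeq,
        lintegral_congr_ae (hae.mono fun z hz => tsum_stickPieces_consSeq hz.1),
        lintegral_add_left (by fun_prop)]
      congr 1
      · rw [lintegral_prod _ (by fun_prop)]
        simp only [lintegral_const, measure_univ, mul_one]
        rw [hν, lintegral_prod _ (by fun_prop)]
        simp only [lintegral_const, measure_univ, mul_one]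
        exact lintegral_Icc_id
      · rw [lintegral_prod_mul (f := fun x : ℝ × (ℕ → ℝ) => ENNReal.ofReal (1 - x.1))
          (by fun_prop) hT.aemeasurable]
        congr 1
        rw [hν, lintegral_prod _ (by fun_prop)]
        simp only [lintegral_const, measure_univ, mul_one]
        exact lintegral_Icc_one_sub
    have hMone : M = 1 := by
      have hfin : M ≠ ⊤ := ne_top_of_le_ne_top ENNReal.one_ne_top hM1
      have h2 := congrArg ENNReal.toReal hMeq
      rw [ENNReal.toReal_add (by simp) (ENNReal.mul_ne_top (by simp) hfin),
        ENNReal.toReal_mul] at h2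
      simp only [ENNReal.toReal_inv, ENNReal.toReal_ofNat] at h2
      rw [← ENNReal.ofReal_toReal hfin, show M.toReal = 1 by linarith, ENNReal.ofReal_one]
    have heq : ∀ᵐ ω ∂P, ∑' p, ENNReal.ofReal (stickPieces ω p) = 1 :=
      ae_eq_of_ae_le_of_lintegral_le hle (ne_top_of_le_ne_top ENNReal.one_ne_top hM1)
        aemeasurable_const (by rw [← hM, hMone]; simp)
    have hpart : ∀ᵐ ω ∂P, IsPartition 1 (sortDesc (stickPieces ω)) := by
      filter_upwards [hPae, heq] with ω h1 h2
      exact isPartition_sortDesc h1.bddAbove_stickPieces h1.stickPieces_nonneg h2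
    refine (ae_map_iff hΦ.aemeasurable ?_).2 (hpart.mono fun _ h => mem_partitionsOfUnity_iff.2 h)
    simpa only [mem_partitionsOfUnity_iff] using measurableSet_isPartition 1
  · refine Measure.ext_of_lintegral _ fun F hF => ?_
    rw [lintegral_map hF hΦ, lintegral_map hF (by fun_prop)]
    conv_lhs => rw [← hPc]
    rw [lintegral_map (f := fun ω => F (sortDesc (stickPieces ω))) (hF.comp hΦ) measurable_consSeq,
      lintegral_congr_ae (hae.mono fun z hz => congrArg F (sortDesc_stickPieces_consSeq hz.1.1 hz.2))]
    have := Measure.isProbabilityMeasure_map (μ := P) hΦ.aemeasurable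
    have hG : Measurable fun z : (ℝ × (ℕ → ℝ)) × (ℕ → ℝ × (ℕ → ℝ)) =>
        F (stickMerge z.1.1 z.1.2 (sortDesc (stickPieces z.2))) :=
      hF.comp (measurable_stickMerge (by fun_prop) (by fun_prop) (hΦ.comp measurable_snd))
    rw [lintegral_prod _ hG.aemeasurable, hν,
      lintegral_prod _ (Measurable.aemeasurable hG.lintegral_prod_right'),
      lintegral_prod _ (Measurable.aemeasurable (by fun_prop))]
    refine lintegral_congr fun u => ?_
    rw [lintegral_prod _ (Measurable.aemeasurable (by fun_prop))]
    refine lintegral_congr fun b => ?_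
    rw [lintegral_map (by fun_prop) hΦ]

end Existence

/-! ### The coupling of block permutations with the limiting partition -/

section Potential

/-- A bound for the expected `ℓ¹` error of the coupling started with a stick of length `s`. -/
def potential (s : ℝ) : ℝ := 5 / 2 * Real.log (1 + 4 * s)

lemma potential_nonneg {s : ℝ} (hs : 0 ≤ s) : 0 ≤ potential s :=
  mul_nonneg (by norm_num) (Real.log_nonneg (by linarith))

lemma integral_potential {s : ℝ} (hs : 0 < s) :
    ∫ u in (0 : ℝ)..1, potential (s * (1 - u))
      = potential s - 5 / 2 + 5 / 2 * (Real.log (1 + 4 * s) / (4 * s)) := by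
  have h1 : ∀ u, potential (s * (1 - u)) = 5 / 2 * Real.log (-(4 * s) * u + (1 + 4 * s)) := by
    intro u; unfold potential; congr 2; ring
  simp_rw [h1]
  rw [intervalIntegral.integral_const_mul,
    intervalIntegral.integral_comp_mul_add (fun x => Real.log x) (by linarith), integral_log]
  simp only [mul_zero, zero_add, mul_one, neg_add_cancel_comm_assoc, smul_eq_mul, Real.log_one,
    potential]
  field_simp
  ring

/-- One step of the coupling costs at most `min 1 s`, and the potential pays for it. -/
lemma min_add_integral_potential_le {s : ℝ} (hs : 0 ≤ s) :
    min 1 s + ∫ u in (0 : ℝ)..1, potential (s * (1 - u)) ≤ potential s := by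
  rcases hs.eq_or_lt with rfl | hs
  · simp [potential]
  rw [integral_potential hs]
  have hY : 0 < 1 + 4 * s := by linarith
  -- `log y ≤ (y - 1 / y) / 2` for `y ≥ 1`, that is, `t ≤ sinh t` for `t ≥ 0`.
  have hlog : Real.log (1 + 4 * s) ≤ ((1 + 4 * s) - (1 + 4 * s)⁻¹) / 2 := by
    rw [← Real.sinh_log hY]
    exact Real.self_le_sinh_iff.2 (Real.log_nonneg (by linarith))
  have h2 : Real.log (1 + 4 * s) / (4 * s) ≤ 1 - 2 * s / (1 + 4 * s) := by
    rw [div_le_iff₀ (by linarith)]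
    refine hlog.trans (le_of_eq ?_)
    field_simp
    ring
  have h3 : min 1 s ≤ 5 / 2 * (2 * s / (1 + 4 * s)) := by
    rw [← mul_div_assoc, le_div_iff₀ hY]
    rcases le_total s 1 with h | h
    · rw [min_eq_right h]; nlinarith
    · rw [min_eq_left h]; linarith
  linarith

lemma continuousOn_potential (s : ℝ) (hs : 0 ≤ s) :
    ContinuousOn (fun u => potential (s * (1 - u))) (Set.Icc 0 1) := by
  unfold potential
  refine continuousOn_const.mul (ContinuousOn.log (by fun_prop) fun u hu => ?_)
  have := mul_nonneg hs (sub_nonneg.2 hu.2)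
  linarith

end Potential

section Floor

lemma volume_floor_eq_of_lt {s : ℝ} (hs : 0 < s) {k : ℕ} (hk : k < ⌊s⌋₊) :
    volume (Set.Icc (0 : ℝ) 1 ∩ {u | ⌊s * (1 - u)⌋₊ = k}) = ENNReal.ofReal s⁻¹ := by
  have hks : (k : ℝ) + 1 ≤ s := by
    have := (Nat.le_floor_iff hs.le).1 (Nat.succ_le_of_lt hk)
    exact_mod_cast this
  have : Set.Icc (0 : ℝ) 1 ∩ {u | ⌊s * (1 - u)⌋₊ = k} = Set.Ioc (1 - (k + 1) / s) (1 - k / s) := by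
    ext u
    simp only [Set.mem_inter_iff, Set.mem_Icc, Set.mem_ofPred_eq, Set.mem_Ioc]
    have e1 : 1 - ((k : ℝ) + 1) / s < u ↔ s * (1 - u) < k + 1 := by
      rw [sub_lt_comm, lt_div_iff₀ hs, mul_comm]
    have e2 : u ≤ 1 - (k : ℝ) / s ↔ k ≤ s * (1 - u) := by
      rw [le_sub_comm, div_le_iff₀ hs, mul_comm]
    rw [e1, e2]
    constructor
    · rintro ⟨⟨h0, h1⟩, h⟩
      have := (Nat.floor_eq_iff (mul_nonneg hs.le (sub_nonneg.2 h1))).1 h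
      exact ⟨this.2, this.1⟩
    · rintro ⟨h1, h2⟩
      have hnn : 0 ≤ s * (1 - u) := le_trans (Nat.cast_nonneg k) h2
      refine ⟨⟨?_, ?_⟩, (Nat.floor_eq_iff hnn).2 ⟨h2, h1⟩⟩
      · nlinarith
      · have := nonneg_of_mul_nonneg_right hnn hs
        linarith
  rw [this, Real.volume_Ioc]
  congr 1
  field_simp
  ring

lemma volume_floor_eq_floor {s : ℝ} (hs : 0 < s) :
    volume (Set.Icc (0 : ℝ) 1 ∩ {u | ⌊s * (1 - u)⌋₊ = ⌊s⌋₊})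
      = ENNReal.ofReal (s⁻¹ * (s - ⌊s⌋₊)) := by
  have : Set.Icc (0 : ℝ) 1 ∩ {u | ⌊s * (1 - u)⌋₊ = ⌊s⌋₊} = Set.Icc 0 (1 - ⌊s⌋₊ / s) := by
    ext u
    simp only [Set.mem_inter_iff, Set.mem_Icc, Set.mem_ofPred_eq]
    have e2 : u ≤ 1 - (⌊s⌋₊ : ℝ) / s ↔ ⌊s⌋₊ ≤ s * (1 - u) := by
      rw [le_sub_comm, div_le_iff₀ hs, mul_comm]
    rw [e2]
    constructor
    · rintro ⟨⟨h0, h1⟩, h⟩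
      exact ⟨h0, ((Nat.floor_eq_iff (mul_nonneg hs.le (sub_nonneg.2 h1))).1 h).1⟩
    · rintro ⟨h0, h2⟩
      have hnn : 0 ≤ s * (1 - u) := le_trans (Nat.cast_nonneg _) h2
      have := nonneg_of_mul_nonneg_right hnn hs
      refine ⟨⟨h0, by linarith⟩, (Nat.floor_eq_iff hnn).2 ⟨h2, ?_⟩⟩
      have := Nat.lt_floor_add_one s
      nlinarith
  rw [this, Real.volume_Icc]
  congr 1
  field_simp
  ring

/-- The integer part of a uniform random point of `[0, s]` is uniform on `{0, …, ⌊s⌋ - 1}` if it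
differs from `⌊s⌋`. -/
lemma lintegral_floor {s : ℝ} (hs : 0 < s) (Ψ : ℕ → ℝ≥0∞) :
    ∫⁻ u in Set.Icc (0 : ℝ) 1, Ψ ⌊s * (1 - u)⌋₊
      = ENNReal.ofReal s⁻¹ * (∑ k ∈ Finset.range ⌊s⌋₊, Ψ k + ENNReal.ofReal (s - ⌊s⌋₊) * Ψ ⌊s⌋₊) := by
  have hm : Measurable fun u : ℝ => ⌊s * (1 - u)⌋₊ := by fun_prop
  have hΨ : Measurable Ψ := measurable_from_nat
  rw [← lintegral_map (μ := volume.restrict (Set.Icc (0 : ℝ) 1)) hΨ hm, lintegral_countable']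
  have hμ : ∀ k, (volume.restrict (Set.Icc (0 : ℝ) 1)).map (fun u : ℝ => ⌊s * (1 - u)⌋₊) {k}
      = volume (Set.Icc (0 : ℝ) 1 ∩ {u | ⌊s * (1 - u)⌋₊ = k}) := by
    intro k
    rw [Measure.map_apply hm (measurableSet_singleton k),
      Measure.restrict_apply (hm (measurableSet_singleton k)), Set.inter_comm]
    rfl
  simp_rw [hμ]
  rw [tsum_eq_sum (s := Finset.range (⌊s⌋₊ + 1)), Finset.sum_range_succ, volume_floor_eq_floor hs,
    Finset.sum_congr rfl fun k hk => by rw [volume_floor_eq_of_lt hs (Finset.mem_range.1 hk)],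
    ← Finset.sum_mul, ENNReal.ofReal_mul (by positivity)]
  · ring
  · intro k hk
    have : Set.Icc (0 : ℝ) 1 ∩ {u | ⌊s * (1 - u)⌋₊ = k} = ∅ := by
      ext u
      simp only [Set.mem_inter_iff, Set.mem_Icc, Set.mem_ofPred_eq, Set.mem_empty_iff_false,
        iff_false, not_and]
      rintro ⟨h0, h1⟩ h
      have h2 : ⌊s * (1 - u)⌋₊ ≤ ⌊s⌋₊ := Nat.floor_mono (by nlinarith)
      rw [Finset.mem_range] at hk
      omega
    rw [this]; simp

end Floor

section Coupling
variable {m : ℕ} {Γ : Subgroup (Equiv.Perm (Fin m))} {A : Measure (ℕ → ℝ)}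
  {Ω : Type} [MeasurableSpace Ω] {P : Measure Ω} {C D : ℝ → Ω → ℕ → ℝ}

/-- A family of couplings, measurable in `s ≥ 0`, of the cycle partition of `⌊s⌋` blocks with the
limiting partition, normalized to have total masses `⌊s⌋` and `s`. -/
structure IsBlockCoupling (Γ : Subgroup (Equiv.Perm (Fin m))) (A : Measure (ℕ → ℝ))
    (P : Measure Ω) (C D : ℝ → Ω → ℕ → ℝ) : Prop where
  measurable_left : Measurable fun p : ℝ × Ω => C p.1 p.2
  measurable_right : Measurable fun p : ℝ × Ω => D p.1 p.2
  map_left : ∀ s, 0 ≤ s → P.map (C s) = blockLaw Γ ⌊s⌋₊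
  map_right : ∀ s, 0 ≤ s → P.map (D s) = A.map fun x i => s * x i

/-- The independent coupling. -/
lemma isBlockCoupling_prod [IsProbabilityMeasure A] :
    IsBlockCoupling Γ A ((Measure.infinitePi (blockLaw Γ)).prod A)
      (fun s p => p.1 ⌊s⌋₊) (fun s p i => s * p.2 i) where
  measurable_left := by
    have h1 : Measurable fun q : ℕ × (ℕ → ℕ → ℝ) => q.2 q.1 :=
      measurable_from_prod_countable_right fun k => measurable_pi_apply k
    exact h1.comp (f := fun p : ℝ × ((ℕ → ℕ → ℝ) × (ℕ → ℝ)) => (⌊p.1⌋₊, p.2.1)) (by fun_prop)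
  measurable_right := by fun_prop
  map_left s hs := by
    have : (fun p : (ℕ → ℕ → ℝ) × (ℕ → ℝ) => p.1 ⌊s⌋₊)
      = (fun c : ℕ → ℕ → ℝ => c ⌊s⌋₊) ∘ Prod.fst := rfl
    rw [this, ← Measure.map_map (measurable_pi_apply _) measurable_fst, ← Measure.fst,
      Measure.fst_prod]
    exact Measure.infinitePi_map_eval (blockLaw Γ) ⌊s⌋₊
  map_right s hs := by
    have : (fun (p : (ℕ → ℕ → ℝ) × (ℕ → ℝ)) i => s * p.2 i)
      = (fun (a : ℕ → ℝ) i => s * a i) ∘ Prod.snd := rfl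
    rw [this, ← Measure.map_map (by fun_prop) measurable_snd, ← Measure.snd, Measure.snd_prod]

lemma IsBlockCoupling.measurable_left_apply (h : IsBlockCoupling Γ A P C D) (s : ℝ) :
    Measurable (C s) := h.measurable_left.comp measurable_prodMk_left

lemma IsBlockCoupling.measurable_right_apply (h : IsBlockCoupling Γ A P C D) (s : ℝ) :
    Measurable (D s) := h.measurable_right.comp measurable_prodMk_left

lemma IsBlockCoupling.ae_left (h : IsBlockCoupling Γ A P C D) (hm : 1 ≤ m) {s : ℝ} (hs : 0 ≤ s) :
    ∀ᵐ ω ∂P, IsPartition (⌊s⌋₊ : ℝ≥0∞) (C s ω) := by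
  have := ae_blockLaw_isPartition Γ hm ⌊s⌋₊
  rw [← h.map_left s hs] at this
  exact ae_of_ae_map (h.measurable_left_apply s).aemeasurable this

lemma IsBlockCoupling.ae_right (h : IsBlockCoupling Γ A P C D)
    (hA : ∀ᵐ a ∂A, IsPartition 1 a) {s : ℝ} (hs : 0 ≤ s) :
    ∀ᵐ ω ∂P, IsPartition (ENNReal.ofReal s) (D s ω) := by
  refine ae_of_ae_map (h.measurable_right_apply s).aemeasurable ?_
  rw [h.map_right s hs]
  refine (ae_map_iff (measurable_const_mul_seq s).aemeasurable
    (measurableSet_isPartition _)).2 (hA.mono fun a ha => ?_)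
  simpa using ha.const_mul hs

/-- The cycle partition after one step: the part of the stick of length `s` beyond its relative
position `1 - u` is broken off, and both stick lengths are rounded down to integers. -/
def stepLeft (C : ℝ → Ω → ℕ → ℝ) (s : ℝ) (p : ℝ × (ℕ → ℝ) × Ω) : ℕ → ℝ :=
  merge (fun i => ((⌊s⌋₊ : ℝ) - ⌊s * (1 - p.1)⌋₊) * p.2.1 i) (C (s * (1 - p.1)) p.2.2)

/-- The limiting partition after the step of `stepLeft`, without rounding. -/
def stepRight (D : ℝ → Ω → ℕ → ℝ) (s : ℝ) (p : ℝ × (ℕ → ℝ) × Ω) : ℕ → ℝ :=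
  merge (fun i => s * p.1 * p.2.1 i) (D (s * (1 - p.1)) p.2.2)

lemma lintegral_step [SFinite P] {φ : ℝ × (ℕ → ℝ) × Ω → ℝ≥0∞} (hφ : Measurable φ) :
    ∫⁻ p, φ p ∂(volume.restrict (Set.Icc (0 : ℝ) 1)).prod ((cycleLaw Γ).prod P)
      = ∫⁻ u in Set.Icc (0 : ℝ) 1, ∫⁻ b, ∫⁻ ω, φ (u, b, ω) ∂P ∂cycleLaw Γ := by
  rw [lintegral_prod _ hφ.aemeasurable]
  refine lintegral_congr fun u => ?_
  rw [lintegral_prod (fun q => φ (u, q)) (hφ.comp measurable_prodMk_left).aemeasurable]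

/-- One more step of the coupling. The two marginals are preserved because both laws have a
stick-breaking recursion. -/
lemma IsBlockCoupling.step [IsProbabilityMeasure P] (h : IsBlockCoupling Γ A P C D) (hm : 1 ≤ m)
    (hA : IsStickLaw (cycleLaw Γ) A) :
    IsBlockCoupling Γ A ((volume.restrict (Set.Icc (0 : ℝ) 1)).prod ((cycleLaw Γ).prod P))
      (stepLeft C) (stepRight D) where
  measurable_left := by
    unfold stepLeft
    refine measurable_merge (by fun_prop) ?_
    exact h.measurable_left.comp
      (f := fun p : ℝ × ℝ × (ℕ → ℝ) × Ω => (p.1 * (1 - p.2.1), p.2.2.2)) (by fun_prop)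
  measurable_right := by
    unfold stepRight
    refine measurable_merge (by fun_prop) ?_
    exact h.measurable_right.comp
      (f := fun p : ℝ × ℝ × (ℕ → ℝ) × Ω => (p.1 * (1 - p.2.1), p.2.2.2)) (by fun_prop)
  map_left s hs := by
    have hmeas : Measurable (stepLeft C s) := by
      unfold stepLeft
      refine measurable_merge (by fun_prop) ?_
      exact h.measurable_left.comp
        (f := fun p : ℝ × (ℕ → ℝ) × Ω => (s * (1 - p.1), p.2.2)) (by fun_prop)
    refine Measure.ext_of_lintegral _ fun F hF => ?_
    rw [lintegral_map hF hmeas, lintegral_step (φ := fun p => F (stepLeft C s p)) (hF.comp hmeas)]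
    let Ψ : ℕ → ℝ≥0∞ := fun k => ∫⁻ b, ∫⁻ c, F (merge (fun i => ((⌊s⌋₊ : ℝ) - k) * b i) c)
      ∂blockLaw Γ k ∂cycleLaw Γ
    have h1 : ∫⁻ u in Set.Icc (0 : ℝ) 1, ∫⁻ b, ∫⁻ ω, F (stepLeft C s (u, b, ω)) ∂P ∂cycleLaw Γ
        = ∫⁻ u in Set.Icc (0 : ℝ) 1, Ψ ⌊s * (1 - u)⌋₊ := by
      refine setLIntegral_congr_fun measurableSet_Icc fun u hu => lintegral_congr fun b => ?_
      have hnn := mul_nonneg hs (sub_nonneg.2 hu.2)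
      rw [← h.map_left _ hnn, lintegral_map (by fun_prop) (h.measurable_left_apply _)]
      rfl
    have hX : Ψ ⌊s⌋₊ = ∫⁻ c, F c ∂blockLaw Γ ⌊s⌋₊ := by
      simp only [Ψ, sub_self, zero_mul]
      rw [lintegral_const, measure_univ, mul_one]
      exact lintegral_congr_ae ((ae_blockLaw_isPartition Γ hm _).mono fun c hc => by
        simp only [merge_zero_left hc])
    change ∫⁻ u in Set.Icc (0 : ℝ) 1, ∫⁻ b, ∫⁻ ω, F (stepLeft C s (u, b, ω)) ∂P ∂cycleLaw Γ = _
    rw [h1]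
    rcases hs.eq_or_lt with rfl | hs
    · rw [← hX]; simp
    · rw [lintegral_floor hs, hX, ← lintegral_blockLaw_recursion, ← add_mul, ← mul_assoc,
        ← ENNReal.ofReal_natCast, ← ENNReal.ofReal_add (Nat.cast_nonneg _)
          (sub_nonneg.2 (Nat.floor_le hs.le)), add_sub_cancel, ← ENNReal.ofReal_mul (by positivity),
        inv_mul_cancel₀ hs.ne', ENNReal.ofReal_one, one_mul]
  map_right s hs := by
    have hmeas : Measurable (stepRight D s) := by
      unfold stepRight
      refine measurable_merge (by fun_prop) ?_
      exact h.measurable_right.comp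
        (f := fun p : ℝ × (ℕ → ℝ) × Ω => (s * (1 - p.1), p.2.2)) (by fun_prop)
    refine Measure.ext_of_lintegral _ fun F hF => ?_
    rw [lintegral_map hF hmeas, lintegral_step (φ := fun p => F (stepRight D s p)) (hF.comp hmeas), lintegral_map hF (by fun_prop),
      hA.lintegral_eq (F := fun a => F fun i => s * a i) (by fun_prop)]
    refine setLIntegral_congr_fun measurableSet_Icc fun u hu => ?_
    refine lintegral_congr_ae ((ae_cycleLaw_isPartition Γ hm).mono fun b hb => ?_)
    have hnn := mul_nonneg hs (sub_nonneg.2 hu.2)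
    change ∫⁻ ω, F (merge (fun i => s * u * b i) (D (s * (1 - u)) ω)) ∂P = _
    rw [← lintegral_map (f := fun d => F (merge (fun i => s * u * b i) d)) (by fun_prop)
      (h.measurable_right_apply _), h.map_right _ hnn, lintegral_map (by fun_prop) (by fun_prop)]
    refine lintegral_congr_ae (hA.ae_isPartition.mono fun a ha => ?_)
    change F _ = F _
    congr 1
    rw [stickMerge_eq_merge, merge, merge, ← sortDesc_const_mul _ hs]
    · congr 1
      funext i
      rcases i with i | i <;> simp [mul_assoc]
    · exact bddAbove_range_sumElim (hb.const_mul hu.1).bddAbove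
        (ha.const_mul (sub_nonneg.2 hu.2)).bddAbove

lemma abs_floor_sub_floor_le {s u : ℝ} (hs : 0 ≤ s) (hu : u ∈ Set.Icc (0 : ℝ) 1) :
    |(⌊s⌋₊ : ℝ) - ⌊s * (1 - u)⌋₊ - s * u| ≤ min 1 s := by
  have hnn := mul_nonneg hs (sub_nonneg.2 hu.2)
  have h1 := Nat.floor_le hs
  have h2 := Nat.lt_floor_add_one s
  have h3 := Nat.floor_le hnn
  have h4 := Nat.lt_floor_add_one (s * (1 - u))
  have h5 := mul_nonneg hs hu.1
  have h6 : (0 : ℝ) ≤ ⌊s⌋₊ := Nat.cast_nonneg _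
  have h7 : (0 : ℝ) ≤ ⌊s * (1 - u)⌋₊ := Nat.cast_nonneg _
  rw [le_min_iff, abs_le, abs_le]
  refine ⟨⟨by linarith, by linarith⟩, ⟨?_, ?_⟩⟩ <;> nlinarith

/-- Rounding errors of single pieces are at most `1`, so that a step does not increase the excess
of the uniform distance over `1`. -/
lemma IsBlockCoupling.lintegral_distLinf_step_le [IsProbabilityMeasure P]
    (h : IsBlockCoupling Γ A P C D) (hm : 1 ≤ m) (hA : IsStickLaw (cycleLaw Γ) A) {s : ℝ}
    (hs : 0 ≤ s) :
    ∫⁻ p, (distLinf (stepLeft C s p) (stepRight D s p) - 1)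
        ∂(volume.restrict (Set.Icc (0 : ℝ) 1)).prod ((cycleLaw Γ).prod P)
      ≤ ∫⁻ u in Set.Icc (0 : ℝ) 1,
        ∫⁻ ω, (distLinf (C (s * (1 - u)) ω) (D (s * (1 - u)) ω) - 1) ∂P := by
  have h' := h.step hm hA
  rw [lintegral_step (φ := fun p => distLinf (stepLeft C s p) (stepRight D s p) - 1)
    ((measurable_distLinf.comp
    ((h'.measurable_left_apply s).prodMk (h'.measurable_right_apply s))).sub measurable_const)]
  refine setLIntegral_mono' measurableSet_Icc fun u hu => ?_
  have hnn := mul_nonneg hs (sub_nonneg.2 hu.2)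
  refine le_trans (lintegral_mono_ae (g := fun _ => ∫⁻ ω,
    (distLinf (C (s * (1 - u)) ω) (D (s * (1 - u)) ω) - 1) ∂P) ?_) (by simp)
  filter_upwards [ae_cycleLaw_isPartition Γ hm] with b hb
  refine lintegral_mono_ae ?_
  filter_upwards [h.ae_left hm hnn, h.ae_right hA.ae_isPartition hnn] with ω hc hd
  have hbb : ∀ x : ℝ, 0 ≤ x → BddAbove (Set.range fun i => x * b i) :=
    fun x hx => (hb.const_mul hx).bddAbove
  have hr : (0 : ℝ) ≤ (⌊s⌋₊ : ℝ) - ⌊s * (1 - u)⌋₊ := sub_nonneg.2 <| Nat.cast_le.2 <|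
    Nat.floor_mono (by nlinarith [hu.1, hu.2])
  rw [tsub_le_iff_right]
  refine (distLinf_merge_le (hbb _ hr) hc.bddAbove (hbb _ (mul_nonneg hs hu.1))
    hd.bddAbove).trans (max_le ?_ le_tsub_add)
  refine (distLinf_le_distL1 _ _).trans ?_
  rw [distL1_const_mul_const_mul hb]
  refine le_trans ?_ le_add_self
  rw [ENNReal.ofReal_le_one]
  exact (abs_floor_sub_floor_le hs hu).trans (min_le_left _ _)

lemma IsBlockCoupling.lintegral_distL1_step_le [IsProbabilityMeasure P]
    (h : IsBlockCoupling Γ A P C D) (hm : 1 ≤ m) (hA : IsStickLaw (cycleLaw Γ) A) {s : ℝ}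
    (hs : 0 ≤ s) :
    ∫⁻ p, distL1 (stepLeft C s p) (stepRight D s p)
        ∂(volume.restrict (Set.Icc (0 : ℝ) 1)).prod ((cycleLaw Γ).prod P)
      ≤ ENNReal.ofReal (min 1 s) + ∫⁻ u in Set.Icc (0 : ℝ) 1,
        ∫⁻ ω, distL1 (C (s * (1 - u)) ω) (D (s * (1 - u)) ω) ∂P := by
  have h' := h.step hm hA
  rw [lintegral_step (φ := fun p => distL1 (stepLeft C s p) (stepRight D s p)) (measurable_distL1.comp
    ((h'.measurable_left_apply s).prodMk (h'.measurable_right_apply s)))]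
  have hconst : ENNReal.ofReal (min 1 s)
      = ∫⁻ _ in Set.Icc (0 : ℝ) 1, ENNReal.ofReal (min 1 s) := by simp
  rw [hconst, ← lintegral_add_left measurable_const]
  refine setLIntegral_mono' measurableSet_Icc fun u hu => ?_
  have hnn := mul_nonneg hs (sub_nonneg.2 hu.2)
  refine le_trans (lintegral_mono_ae (g := fun _ => ENNReal.ofReal (min 1 s) + ∫⁻ ω,
    distL1 (C (s * (1 - u)) ω) (D (s * (1 - u)) ω) ∂P) ?_) (by simp)
  filter_upwards [ae_cycleLaw_isPartition Γ hm] with b hb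
  have hconst' : ENNReal.ofReal (min 1 s) = ∫⁻ _, ENNReal.ofReal (min 1 s) ∂P := by simp
  rw [hconst', ← lintegral_add_left measurable_const]
  refine lintegral_mono_ae ?_
  filter_upwards [h.ae_left hm hnn, h.ae_right hA.ae_isPartition hnn] with ω hc hd
  have hr : (0 : ℝ) ≤ (⌊s⌋₊ : ℝ) - ⌊s * (1 - u)⌋₊ := sub_nonneg.2 <| Nat.cast_le.2 <|
    Nat.floor_mono (by nlinarith [hu.1, hu.2])
  refine (distL1_merge_le (hb.const_mul hr) hc (hb.const_mul (mul_nonneg hs hu.1)) hd).trans ?_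
  rw [distL1_const_mul_const_mul hb]
  gcongr
  exact abs_floor_sub_floor_le hs hu

lemma lintegral_ofReal_mul_one_sub {s : ℝ} (hs : 0 ≤ s) (c : ℝ≥0∞) :
    ∫⁻ u in Set.Icc (0 : ℝ) 1, ENNReal.ofReal (2 * (s * (1 - u))) * c
      = ENNReal.ofReal (2 * s) * (2⁻¹ * c) := by
  simp_rw [← mul_assoc (2 : ℝ) s, ENNReal.ofReal_mul (show 0 ≤ 2 * s by positivity)]
  rw [lintegral_mul_const _ (by fun_prop), lintegral_const_mul _ (by fun_prop),
    lintegral_Icc_one_sub, mul_assoc]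

/-- The coupling after `N` steps. The terms with `2⁻¹ ^ N` bound the error of the independent coupling
used for what is left of the stick. -/
theorem exists_isBlockCoupling (hm : 1 ≤ m) (hA : IsStickLaw (cycleLaw Γ) A) (N : ℕ) :
    ∃ (Ω : Type) (_ : MeasurableSpace Ω) (P : Measure Ω) (_ : IsProbabilityMeasure P)
      (C D : ℝ → Ω → ℕ → ℝ), IsBlockCoupling Γ A P C D ∧ ∀ s, 0 ≤ s →
        ∫⁻ ω, (distLinf (C s ω) (D s ω) - 1) ∂P ≤ ENNReal.ofReal (2 * s) * 2⁻¹ ^ N ∧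
        ∫⁻ ω, distL1 (C s ω) (D s ω) ∂P
          ≤ ENNReal.ofReal (potential s) + ENNReal.ofReal (2 * s) * 2⁻¹ ^ N := by
  have := hA.isProbabilityMeasure
  induction N with
  | zero =>
    refine ⟨_, _, _, inferInstance, _, _, isBlockCoupling_prod (Γ := Γ) (A := A), fun s hs => ?_⟩
    have h := isBlockCoupling_prod (Γ := Γ) (A := A)
    have hle := (h.ae_left hm hs).and (h.ae_right hA.ae_isPartition hs)
    have hle' := hle.mono fun ω hω => (distL1_le_add hω.1 hω.2).trans
      (show (⌊s⌋₊ : ℝ≥0∞) + ENNReal.ofReal s ≤ ENNReal.ofReal (2 * s) by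
        rw [← ENNReal.ofReal_natCast, ← ENNReal.ofReal_add (Nat.cast_nonneg _) hs]
        exact ENNReal.ofReal_le_ofReal (by linarith [Nat.floor_le hs]))
    have hint : ∫⁻ ω, distL1 (ω.1 ⌊s⌋₊) (fun i => s * ω.2 i) ∂(Measure.infinitePi
        (blockLaw Γ)).prod A ≤ ENNReal.ofReal (2 * s) :=
      (lintegral_mono_ae hle').trans (by simp)
    rw [pow_zero, mul_one]
    refine ⟨le_trans (lintegral_mono fun ω => ?_) hint, hint.trans le_add_self⟩
    exact tsub_le_self.trans (distLinf_le_distL1 _ _)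
  | succ N ih =>
    obtain ⟨Ω, _, P, _, C, D, h, hd⟩ := ih
    refine ⟨_, _, _, inferInstance, _, _, h.step hm hA, fun s hs => ⟨?_, ?_⟩⟩
    · refine (h.lintegral_distLinf_step_le hm hA hs).trans ?_
      rw [pow_succ', ← lintegral_ofReal_mul_one_sub hs]
      exact setLIntegral_mono' measurableSet_Icc fun u hu =>
        (hd _ (mul_nonneg hs (sub_nonneg.2 hu.2))).1
    · refine (h.lintegral_distL1_step_le hm hA hs).trans ?_
      refine (add_le_add_right (setLIntegral_mono' measurableSet_Icc fun u hu =>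
        (hd _ (mul_nonneg hs (sub_nonneg.2 hu.2))).2) _).trans ?_
      rw [lintegral_add_right _ (by fun_prop), lintegral_ofReal_mul_one_sub hs, ← pow_succ',
        ← add_assoc, lintegral_Icc_ofReal (continuousOn_potential s hs)
          (fun u hu => potential_nonneg (mul_nonneg hs (sub_nonneg.2 hu.2))),
        ← ENNReal.ofReal_add (le_min zero_le_one hs)]
      · gcongr
        exact min_add_integral_potential_le hs
      · exact intervalIntegral.integral_nonneg zero_le_one fun u hu =>
          potential_nonneg (mul_nonneg hs (sub_nonneg.2 hu.2))

end Coupling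

/-! ### Transport distances -/

section Wasserstein
variable {m : ℕ} {Γ : Subgroup (Equiv.Perm (Fin m))} {A : Measure (ℕ → ℝ)}

lemma wasserstein_le {ρ : (ℕ → ℝ) → (ℕ → ℝ) → ℝ≥0∞} {μ ν : Measure (ℕ → ℝ)}
    (π : Measure ((ℕ → ℝ) × (ℕ → ℝ))) (h1 : π.fst = μ) (h2 : π.snd = ν) :
    wasserstein ρ μ ν ≤ ∫⁻ p, ρ p.1 p.2 ∂π :=
  iInf₂_le π ⟨h1, h2⟩

/-- Running the coupling from the stick length `n` and rescaling by `1 / n`. -/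
lemma IsBlockCoupling.wasserstein_le {Ω : Type} [MeasurableSpace Ω] {P : Measure Ω}
    {C D : ℝ → Ω → ℕ → ℝ} (h : IsBlockCoupling Γ A P C D) (hm : 1 ≤ m) {n : ℕ} (hn : 1 ≤ n)
    {ρ : (ℕ → ℝ) → (ℕ → ℝ) → ℝ≥0∞} (hρ : Measurable fun p : (ℕ → ℝ) × (ℕ → ℝ) => ρ p.1 p.2)
    (hc : ∀ x y, ρ (fun i => 1 / (n : ℝ) * x i) (fun i => 1 / (n : ℝ) * y i)
      = ENNReal.ofReal (1 / n) * ρ x y) :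
    wasserstein ρ (cycleLaw (wreath Γ n)) A
      ≤ ENNReal.ofReal (1 / n) * ∫⁻ ω, ρ (C n ω) (D n ω) ∂P := by
  have hC := h.measurable_left_apply n
  have hD := h.measurable_right_apply n
  have hn0 : (n : ℝ) ≠ 0 := by positivity
  have hm1 : Measurable fun ω i => 1 / (n : ℝ) * C n ω i :=
    (measurable_const_mul_seq _).comp hC
  have hm2 : Measurable fun ω i => 1 / (n : ℝ) * D n ω i :=
    (measurable_const_mul_seq _).comp hD
  refine (BlockPerm.wasserstein_le (P.map fun ω =>
    (fun i => 1 / (n : ℝ) * C n ω i, fun i => 1 / (n : ℝ) * D n ω i)) ?_ ?_).trans ?_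
  · rw [Measure.fst_map_prodMk hm2, cycleLaw_wreath Γ hm]
    have := h.map_left n (Nat.cast_nonneg n)
    rw [Nat.floor_natCast] at this
    rw [← this, Measure.map_map (measurable_const_mul_seq _) hC]
    rfl
  · rw [Measure.snd_map_prodMk hm1]
    have := congrArg (Measure.map fun (x : ℕ → ℝ) i => 1 / (n : ℝ) * x i)
      (h.map_right n (Nat.cast_nonneg n))
    rw [Measure.map_map (measurable_const_mul_seq _) hD,
      Measure.map_map (measurable_const_mul_seq _) (measurable_const_mul_seq _)] at this
    refine Eq.trans this ?_
    convert Measure.map_id using 2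
    funext x i
    simp only [Function.comp, id]
    field_simp
  · rw [lintegral_map hρ (hm1.prodMk hm2), ← lintegral_const_mul' _ _ ENNReal.ofReal_ne_top]
    simp_rw [hc]
    rfl

lemma le_of_forall_add_pow {a b c : ℝ≥0∞} (hc : c ≠ ⊤) (h : ∀ N : ℕ, a ≤ b + c * 2⁻¹ ^ N) :
    a ≤ b := by
  have ht : Filter.Tendsto (fun N : ℕ => b + c * (2⁻¹ : ℝ≥0∞) ^ N) Filter.atTop
      (nhds (b + c * 0)) :=
    (ENNReal.Tendsto.const_mul (ENNReal.tendsto_pow_atTop_nhds_zero_of_lt_one (by simp))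
      (.inr hc)).const_add b
  rw [mul_zero, add_zero] at ht
  exact ge_of_tendsto' ht h

theorem wasserstein_distLinf_le (hm : 1 ≤ m) (hA : IsStickLaw (cycleLaw Γ) A) {n : ℕ}
    (hn : 1 ≤ n) :
    wasserstein distLinf (cycleLaw (wreath Γ n)) A ≤ ENNReal.ofReal (1 / (n : ℝ)) := by
  refine le_of_forall_add_pow (c := ENNReal.ofReal (1 / n) * ENNReal.ofReal (2 * n)) (by finiteness)
    fun N => ?_
  obtain ⟨Ω, _, P, _, C, D, h, hd⟩ := exists_isBlockCoupling hm hA N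
  refine (h.wasserstein_le hm hn measurable_distLinf
    (distLinf_const_mul (by positivity))).trans ?_
  have h1 : ∫⁻ ω, distLinf (C n ω) (D n ω) ∂P
      ≤ 1 + ∫⁻ ω, (distLinf (C n ω) (D n ω) - 1) ∂P := by
    refine (lintegral_mono (g := fun ω => 1 + (distLinf (C n ω) (D n ω) - 1))
      fun ω => le_add_tsub).trans ?_
    rw [lintegral_add_left measurable_const]
    simp
  refine (mul_le_mul_right (h1.trans (add_le_add_right (hd n (Nat.cast_nonneg n)).1 _)) _).trans ?_
  rw [mul_add, mul_one, mul_assoc]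

theorem wasserstein_distL1_le (hm : 1 ≤ m) (hA : IsStickLaw (cycleLaw Γ) A) {n : ℕ}
    (hn : 1 ≤ n) :
    wasserstein distL1 (cycleLaw (wreath Γ n)) A ≤ ENNReal.ofReal (potential n / n) := by
  refine le_of_forall_add_pow (c := ENNReal.ofReal (1 / n) * ENNReal.ofReal (2 * n)) (by finiteness)
    fun N => ?_
  obtain ⟨Ω, _, P, _, C, D, h, hd⟩ := exists_isBlockCoupling hm hA N
  refine (h.wasserstein_le hm hn measurable_distL1 (distL1_const_mul (by positivity))).trans ?_
  refine (mul_le_mul_right (hd n (Nat.cast_nonneg n)).2 _).trans ?_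
  rw [mul_add, mul_assoc, ← ENNReal.ofReal_mul (by positivity), one_div_mul_eq_div]

lemma potential_le {n : ℕ} (hn : 1 ≤ n) :
    potential n ≤ 3 * (Real.log n + Real.eulerMascheroniConstant) + Real.exp 6 / n := by
  have hn1 : (1 : ℝ) ≤ n := by exact_mod_cast hn
  have hn0 : (0 : ℝ) < n := by linarith
  have h1 : Real.log (1 + 4 * n) ≤ Real.log 5 + Real.log n := by
    rw [← Real.log_mul (by norm_num) hn0.ne']
    exact Real.log_le_log (by linarith) (by linarith)
  have h5 : Real.log 5 ≤ 2 := by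
    rw [Real.log_le_iff_le_exp (by norm_num)]
    have := Real.add_one_le_exp (1 : ℝ)
    have h2 : Real.exp 2 = Real.exp 1 * Real.exp 1 := by rw [← Real.exp_add]; norm_num
    have := Real.exp_one_gt_d9
    nlinarith
  -- `log x ≥ 1 - 1 / x` for `x = n / exp 6`.
  have h6 : 7 ≤ Real.log n + Real.exp 6 / n := by
    have := Real.one_sub_inv_le_log_of_pos (show 0 < n / Real.exp 6 by positivity)
    rw [Real.log_div hn0.ne' (Real.exp_pos 6).ne', Real.log_exp, inv_div] at this
    linarith
  have h7 := Real.one_half_lt_eulerMascheroniConstant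
  have h8 : 0 < Real.exp 6 / n := by positivity
  unfold potential
  linarith

end Wasserstein

end BlockPerm

end

theorem theorem5p1 :
    ∃ K : ℝ, ∀ (m : ℕ), 1 ≤ m → ∀ Γ : Subgroup (Equiv.Perm (Fin m)),
      (∃! A : Measure (ℕ → ℝ), BlockPerm.IsStickLaw (BlockPerm.cycleLaw Γ) A) ∧
      ∀ A : Measure (ℕ → ℝ), BlockPerm.IsStickLaw (BlockPerm.cycleLaw Γ) A →
        ∀ n : ℕ, 1 ≤ n →
          BlockPerm.wasserstein BlockPerm.distLinf
              (BlockPerm.cycleLaw (BlockPerm.wreath Γ n)) A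
            ≤ ENNReal.ofReal (1 / (n : ℝ)) ∧
          BlockPerm.wasserstein BlockPerm.distL1
              (BlockPerm.cycleLaw (BlockPerm.wreath Γ n)) A
            ≤ ENNReal.ofReal
                (3 * (Real.log n + Real.eulerMascheroniConstant) / n + K / (n : ℝ) ^ 2) := by
  refine ⟨Real.exp 6, fun m hm Γ => ?_⟩
  have hB := BlockPerm.ae_cycleLaw_isPartition Γ hm
  refine ⟨?_, fun A hA n hn => ⟨BlockPerm.wasserstein_distLinf_le hm hA hn,
    (BlockPerm.wasserstein_distL1_le hm hA hn).trans (ENNReal.ofReal_le_ofReal ?_)⟩⟩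
  · obtain ⟨A, hA⟩ := BlockPerm.exists_isStickLaw hB
    exact ⟨A, hA, fun A' hA' => hA'.unique hB hA⟩
  · have hn0 : (0 : ℝ) < n := by exact_mod_cast hn
    have := div_le_div_of_nonneg_right (BlockPerm.potential_le hn) hn0.le
    rw [add_div, div_div, ← pow_two] at this
    exact this
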